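/- Let $\Gamma$ be a finitely generated polycyclic group, that is, a finitely generated group with a series of subgroups $\{1\}=\Gamma_0\subseteq\Gamma_1\subseteq\dots\subseteq\Gamma_n=\Gamma$ in which each $\Gamma_i$ is normal in $\Gamma_{i+1}$ and each $\Gamma_{i+1}/\Gamma_i$ is cyclic (a polycyclic series). Let the Hirsch length $h(\Gamma)$ be the number of factors $\Gamma_{i+1}/\Gamma_i$ isomorphic to $\mathbb Z$ in such a series, and let $\operatorname{asdim}\Gamma$ be the asymptotic dimension of the metric space $(\Gamma,d_S)$, where $S$ is a finite symmetric generating set, $d_S(g,h)=\|g^{-1}h\|_S$ and $\|g\|_S$ is the length of a shortest word in $S$ that represents $g$. Here the asymptotic dimension of a nonempty metric space $X$ is the least integer $m\ge 0$ (or $\infty$, if there is none) such that for every uniformly bounded open cover $\mathcal V$ of $X$ there is a uniformly bounded open cover $\mathcal U$ of $X$ such that every point of $X$ lies in at most $m+1$ members of $\mathcal U$ and every member of $\mathcal V$ is contained in a member of $\mathcal U$. Then $$\operatorname{asdim}\Gamma = h(\Gamma).$$ Here $\operatorname{asdim}\Gamma$ does not depend on the choice of $S$, and $h(\Gamma)$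 does not depend on the choice of the polycyclic series. -/

import Mathlib

/-! ### Asymptotic dimension of a metric space -/

section AsymptoticDimension

variable {X : Type*}

/-- A family of subsets of a metric space is uniformly bounded if the diameters of its members
have a common bound. -/
def UniformlyBounded [MetricSpace X] (𝒰 : Set (Set X)) : Prop :=
  ∃ R : ℝ, ∀ U ∈ 𝒰, ∀ x ∈ U, ∀ y ∈ U, dist x y ≤ R

/-- A uniformly bounded cover by open sets. -/
structure IsUniformlyBoundedOpenCover [MetricSpace X] (𝒰 : Set (Set X)) : Prop where
  isOpen : ∀ U ∈ 𝒰, IsOpen U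
  covers : ⋃₀ 𝒰 = Set.univ
  bounded : UniformlyBounded 𝒰

/-- Every point lies in at most `m` members of the family. -/
def MultiplicityLE (𝒰 : Set (Set X)) (m : ℕ) : Prop :=
  ∀ x : X, {U | U ∈ 𝒰 ∧ x ∈ U}.encard ≤ m

/-- Every member of `𝒱` is contained in a member of `𝒰`. -/
def Refines (𝒱 𝒰 : Set (Set X)) : Prop :=
  ∀ V ∈ 𝒱, ∃ U ∈ 𝒰, V ⊆ U

/-- `asdim X ≤ n`: every uniformly bounded open cover refines a uniformly bounded open cover of
multiplicity at most `n + 1`. -/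
def AsdimLE (X : Type*) [MetricSpace X] (n : ℕ) : Prop :=
  ∀ 𝒱 : Set (Set X), IsUniformlyBoundedOpenCover 𝒱 →
    ∃ 𝒰 : Set (Set X), IsUniformlyBoundedOpenCover 𝒰 ∧ MultiplicityLE 𝒰 (n + 1) ∧ Refines 𝒱 𝒰

/-- The asymptotic dimension of a (nonempty) metric space: the least `n` with `asdim X ≤ n`, and
`⊤` if there is none. -/
noncomputable def asdim (X : Type*) [MetricSpace X] : ℕ∞ :=
  ⨅ (n : ℕ) (_ : AsdimLE X n), (n : ℕ∞)

end AsymptoticDimension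

/-! ### Word metrics and the asymptotic dimension of a finitely generated group -/

section WordMetric

variable {G : Type*} [Group G]

/-- `S` is a finite symmetric generating set of the group `G`. -/
structure IsFiniteSymmGenSet (S : Set G) : Prop where
  finite : S.Finite
  symm : ∀ s ∈ S, s⁻¹ ∈ S
  generates : Subgroup.closure S = ⊤

/-- The length of a shortest word in the letters `S` that represents `g`. -/
noncomputable def wordNorm (S : Set G) (g : G) : ℕ :=
  sInf {n : ℕ | ∃ w : List G, (∀ s ∈ w, s ∈ S) ∧ w.prod = g ∧ w.length = n}

theorem wordNorm_le_length {S : Set G} {w : List G} (hw : ∀ s ∈ w, s ∈ S) :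
    wordNorm S w.prod ≤ w.length :=
  Nat.sInf_le ⟨w, hw, rfl, rfl⟩

theorem exists_word {S : Set G} (hS : IsFiniteSymmGenSet S) (g : G) :
    ∃ w : List G, (∀ s ∈ w, s ∈ S) ∧ w.prod = g ∧ w.length = wordNorm S g := by
  have hg : g ∈ Subgroup.closure S := by rw [hS.generates]; trivial
  rw [← Subgroup.mem_toSubmonoid, Subgroup.closure_toSubmonoid] at hg
  obtain ⟨l, hl, hlg⟩ := Submonoid.exists_list_of_mem_closure hg
  have hl' : ∀ s ∈ l, s ∈ S := fun s hs =>
    (hl s hs).elim id fun h => by simpa using hS.symm _ h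
  exact Nat.sInf_mem
    (s := {n : ℕ | ∃ w : List G, (∀ s ∈ w, s ∈ S) ∧ w.prod = g ∧ w.length = n})
    ⟨l.length, l, hl', hlg, rfl⟩

theorem wordNorm_one (S : Set G) : wordNorm S (1 : G) = 0 := by
  simpa using wordNorm_le_length (S := S) (w := []) (by simp)

theorem eq_one_of_wordNorm_eq_zero {S : Set G} (hS : IsFiniteSymmGenSet S) {g : G}
    (hg : wordNorm S g = 0) : g = 1 := by
  obtain ⟨w, -, hw, hn⟩ := exists_word hS g
  rw [hg, List.length_eq_zero_iff] at hn
  simpa [hn] using hw.symm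

theorem wordNorm_mul_le {S : Set G} (hS : IsFiniteSymmGenSet S) (g h : G) :
    wordNorm S (g * h) ≤ wordNorm S g + wordNorm S h := by
  obtain ⟨v, hv, hvg, hvn⟩ := exists_word hS g
  obtain ⟨w, hw, hwg, hwn⟩ := exists_word hS h
  have := wordNorm_le_length (S := S) (w := v ++ w)
    (fun s hs => (List.mem_append.1 hs).elim (hv s) (hw s))
  rwa [List.prod_append, hvg, hwg, List.length_append, hvn, hwn] at this

theorem wordNorm_inv_le {S : Set G} (hS : IsFiniteSymmGenSet S) (g : G) :
    wordNorm S g⁻¹ ≤ wordNorm S g := by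
  obtain ⟨w, hw, hwg, hwn⟩ := exists_word hS g
  have := wordNorm_le_length (S := S) (w := (w.map fun x => x⁻¹).reverse) (by
    intro s hs
    obtain ⟨t, ht, rfl⟩ := List.mem_map.1 (List.mem_reverse.1 hs)
    exact hS.symm t (hw t ht))
  rwa [← List.prod_inv_reverse, hwg, List.length_reverse, List.length_map, hwn] at this

theorem wordNorm_inv {S : Set G} (hS : IsFiniteSymmGenSet S) (g : G) :
    wordNorm S g⁻¹ = wordNorm S g :=
  le_antisymm (wordNorm_inv_le hS g) (by simpa using wordNorm_inv_le hS g⁻¹)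

/-- The left-invariant word metric `d_S(g, h) = ‖g⁻¹ h‖_S`. -/
@[reducible] noncomputable def wordMetricSpace (S : Set G) (hS : IsFiniteSymmGenSet S) :
    MetricSpace G where
  dist g h := (wordNorm S (g⁻¹ * h) : ℝ)
  dist_self g := by simp [wordNorm_one]
  dist_comm g h := by
    have : h⁻¹ * g = (g⁻¹ * h)⁻¹ := by group
    rw [this, wordNorm_inv hS]
  dist_triangle g h k := by
    have : g⁻¹ * k = (g⁻¹ * h) * (h⁻¹ * k) := by group
    rw [this]
    exact_mod_cast wordNorm_mul_le hS _ _
  eq_of_dist_eq_zero {g h} hgh :=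
    inv_mul_eq_one.1 (eq_one_of_wordNorm_eq_zero hS (by exact_mod_cast hgh))

/-- The asymptotic dimension of `G` in the word metric `d_S`. -/
noncomputable def asdimWord (S : Set G) (hS : IsFiniteSymmGenSet S) : ℕ∞ :=
  letI : MetricSpace G := wordMetricSpace S hS
  asdim G

theorem exists_isFiniteSymmGenSet (G : Type*) [Group G] [Group.FG G] :
    ∃ S : Set G, IsFiniteSymmGenSet S := by
  obtain ⟨T, hT, hfin⟩ := Group.fg_iff.1 (inferInstance : Group.FG G)
  refine ⟨T ∪ T⁻¹, hfin.union hfin.inv, ?_, ?_⟩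
  · rintro s (hs | hs)
    · exact Or.inr (by simpa using hs)
    · exact Or.inl hs
  · exact top_le_iff.1 (hT ▸ Subgroup.closure_mono Set.subset_union_left)

/-- The asymptotic dimension of a finitely generated group: that of its word metric for some
finite symmetric generating set. -/
noncomputable def groupAsdim (G : Type*) [Group G] [Group.FG G] : ℕ∞ :=
  asdimWord (exists_isFiniteSymmGenSet G).choose (exists_isFiniteSymmGenSet G).choose_spec

end WordMetric

/-! ### Polycyclic groups and the Hirsch length -/

section Polycyclic

/-- A series `1 = G₀ ≤ G₁ ≤ ⋯ ≤ Gₙ = G` with each `Gᵢ` normal in `Gᵢ₊₁` and each factor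
`Gᵢ₊₁ / Gᵢ` cyclic. -/
structure PolycyclicSeries (G : Type*) [Group G] where
  length : ℕ
  subgroup : Fin (length + 1) → Subgroup G
  bot : subgroup 0 = ⊥
  top : subgroup (Fin.last length) = ⊤
  le : ∀ i : Fin length, subgroup i.castSucc ≤ subgroup i.succ
  normal : ∀ i : Fin length, ((subgroup i.castSucc).subgroupOf (subgroup i.succ)).Normal
  cyclic : ∀ i : Fin length,
    haveI := normal i
    IsCyclic (subgroup i.succ ⧸ (subgroup i.castSucc).subgroupOf (subgroup i.succ))

/-- The number of factors `Gᵢ₊₁ / Gᵢ` of the series that are isomorphic to `ℤ`. -/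
noncomputable def PolycyclicSeries.hirsch {G : Type*} [Group G] (σ : PolycyclicSeries G) : ℕ :=
  {i : Fin σ.length |
    haveI := σ.normal i
    Nonempty ((σ.subgroup i.succ ⧸ (σ.subgroup i.castSucc).subgroupOf (σ.subgroup i.succ)) ≃*
      Multiplicative ℤ)}.ncard

/-- A group is polycyclic if it has a polycyclic series. -/
def IsPolycyclic (G : Type*) [Group G] : Prop :=
  Nonempty (PolycyclicSeries G)

/-- The Hirsch length of a polycyclic group: the number of infinite cyclic factors of some
polycyclic series. -/
noncomputable def hirschLength (G : Type*) [Group G] (hG : IsPolycyclic G) : ℕ :=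
  (Classical.choice hG).hirsch

end Polycyclic

/-! Everything passes through `LabelDimLE`: self-labellings of the group of bounded displacement
with at most n + 1 values on each translate of a given finite set. Word balls are finite and every
set is open, so this is equivalent to `AsdimLE` for each generating set. For each polycyclic series,
the Hirsch length turns out to be the least such n; this gives both the equality and the
independence of the choices.

Lower bound. Some subgroup N of finite index is built from the trivial group by h successive
infinite cyclic extensions. It behaves like the fundamental group of a closed aspherical h-manifold:
modulo 2 its homology vanishes above degree h, and a class in degree h is detected by summing a
locally finite cocycle φ over N-translates (`HasTopClass`). The Wang sequence and a cup product with
a jump function of the height carry this across an extension by ℤ (`HasTopClass.extension`). A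
labelling with at most n + 1 ≤ h values on translates of the simplices of the cycle maps these
simplices to degenerate ones, so the induced sorted chain map kills them. That map is homotopic to
the identity by a homotopy of bounded displacement, so φ sums to zero on the cycle, a contradiction
(`HasTopClass.le_of_labelDimLE`).

Upper bound. Labels can be traded for colours (`LabelDimLE.colorDimLE` and `ColorDimLE.labelDimLE`).
Finite cyclic factors cost nothing. For an infinite one, M is cut into slabs by height, each
coarsely a copy of N. On the way from the middle of a slab to its end the colours pass one at a time
to a labelling centred at that end, and the transition costs one extra label
(`ColorDimLE.infinite_extension`). -/

/-! ### Ordered chains modulo two -/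

/-- Chains modulo two whose simplices are finite lists of vertices. -/
abbrev ListChain (X : Type*) := List X →₀ ZMod 2

namespace ListChain

variable {X : Type*}

theorem eq_zero_or_one (a : ZMod 2) : a = 0 ∨ a = 1 := by
  revert a
  decide

/-- With `P = ⊥` applied to a difference of maps, this proves linear identities that hold only on
simplices of a special kind. -/
theorem map_mem_of_mem_supported {M : Type*} [AddCommGroup M] [Module (ZMod 2) M]
    (f : ListChain X →ₗ[ZMod 2] M) (P : Submodule (ZMod 2) M) {s : Set (List X)}
    (hf : ∀ l ∈ s, f (Finsupp.single l 1) ∈ P) {c : ListChain X}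
    (hc : c ∈ Finsupp.supported (ZMod 2) (ZMod 2) s) : f c ∈ P := by
  rw [Finsupp.supported_eq_span_single] at hc
  have : Submodule.span (ZMod 2) ((fun i => Finsupp.single i (1 : ZMod 2)) '' s) ≤ P.comap f := by
    rw [Submodule.span_le]
    rintro _ ⟨l, hl, rfl⟩
    exact hf l hl
  exact this hc

theorem hom_ext {M : Type*} [AddCommGroup M] [Module (ZMod 2) M]
    {f g : ListChain X →ₗ[ZMod 2] M}
    (h : ∀ l, f (Finsupp.single l 1) = g (Finsupp.single l 1)) : f = g :=
  Finsupp.lhom_ext' fun l => LinearMap.ext_ring (h l)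

/-- The cone with apex `x`. -/
noncomputable def cone (x : X) : ListChain X →ₗ[ZMod 2] ListChain X :=
  Finsupp.lmapDomain _ _ (List.cons x)

@[simp] theorem cone_single (x : X) (l : List X) (a : ZMod 2) :
    cone x (Finsupp.single l a) = Finsupp.single (x :: l) a := by
  simp [cone, Finsupp.mapDomain_single]

/-- The boundary of a simplex. -/
noncomputable def bdryList : List X → ListChain X
  | [] => 0
  | x :: l => Finsupp.single l 1 + cone x (bdryList l)

/-- The boundary map of the augmented complex of ordered chains. -/
noncomputable def bdry : ListChain X →ₗ[ZMod 2] ListChain X :=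
  Finsupp.linearCombination (ZMod 2) bdryList

theorem bdry_single (l : List X) : bdry (Finsupp.single l 1) = bdryList l := by
  simp [bdry]

@[simp] theorem bdry_nil : bdry (Finsupp.single ([] : List X) 1) = 0 := by
  simp [bdry, bdryList]

theorem bdry_cone (x : X) (c : ListChain X) : bdry (cone x c) = c + cone x (bdry c) := by
  have : bdry ∘ₗ cone x = LinearMap.id + cone x ∘ₗ bdry := hom_ext fun l => by
    simp [bdry_single, bdryList]
  exact LinearMap.congr_fun this c

theorem bdry_cons (x : X) (l : List X) :
    bdry (Finsupp.single (x :: l) 1) = Finsupp.single l 1 + cone x (bdry (Finsupp.single l 1)) := by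
  rw [← cone_single, bdry_cone]

theorem bdry_bdry (c : ListChain X) : bdry (bdry c) = 0 := by
  have : bdry ∘ₗ bdry = (0 : ListChain X →ₗ[ZMod 2] ListChain X) := hom_ext fun l => by
    induction l with
    | nil => simp
    | cons x l ih =>
      simp only [LinearMap.comp_apply, LinearMap.zero_apply] at ih ⊢
      rw [bdry_cons, map_add, bdry_cone, ih, map_zero, add_zero, ZModModule.add_self]
  exact LinearMap.congr_fun this c

/-- Chains spanned by the simplices with `d` vertices, all in `s`. -/
noncomputable def homog (s : Set X) (d : ℕ) : Submodule (ZMod 2) (ListChain X) :=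
  Finsupp.supported _ _ {l | l.length = d ∧ ∀ x ∈ l, x ∈ s}

theorem single_mem_homog {s : Set X} {d : ℕ} {l : List X} (hl : l.length = d)
    (hs : ∀ x ∈ l, x ∈ s) (a : ZMod 2) : Finsupp.single l a ∈ homog s d :=
  Finsupp.single_mem_supported _ _ ⟨hl, hs⟩

theorem homog_mono {s t : Set X} (h : s ⊆ t) (d : ℕ) : homog s d ≤ homog t d :=
  Finsupp.supported_mono fun _ hl => ⟨hl.1, fun x hx => h (hl.2 x hx)⟩

theorem cone_mem_homog {s : Set X} {d : ℕ} {x : X} (hx : x ∈ s) {c : ListChain X}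
    (hc : c ∈ homog s d) : cone x c ∈ homog s (d + 1) := by
  refine map_mem_of_mem_supported (cone x) _ (fun l hl => ?_) hc
  rw [cone_single]
  refine single_mem_homog (by simp [hl.1]) ?_ _
  simpa [hx] using hl.2

theorem bdryList_mem_homog {s : Set X} {l : List X} (hs : ∀ x ∈ l, x ∈ s) :
    bdryList l ∈ homog s (l.length - 1) := by
  induction l with
  | nil => exact zero_mem _
  | cons x l ih =>
    simp only [List.mem_cons, forall_eq_or_imp] at hs
    refine add_mem (single_mem_homog rfl hs.2 _) ?_
    cases l with
    | nil => simp [bdryList]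
    | cons y l => exact cone_mem_homog hs.1 (ih hs.2)

theorem bdry_mem_homog {s : Set X} {d : ℕ} {c : ListChain X} (hc : c ∈ homog s (d + 1)) :
    bdry c ∈ homog s d := by
  refine map_mem_of_mem_supported bdry _ (fun l hl => ?_) hc
  rw [bdry_single]
  simpa [hl.1] using bdryList_mem_homog hl.2

theorem homog_zero {s : Set X} {c : ListChain X} (hc : c ∈ homog s 0) :
    c = Finsupp.single [] (c []) := by
  ext l
  by_cases hl : l = []
  · simp [hl]
  · rw [Finsupp.single_eq_of_ne (by simpa using hl)]
    refine Finsupp.notMem_support_iff.1 fun h => hl ?_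
    exact List.length_eq_zero_iff.1 (hc h).1

/-- The evaluation of a cochain on chains. -/
noncomputable def pair (φ : List X → ZMod 2) : ListChain X →ₗ[ZMod 2] ZMod 2 :=
  Finsupp.linearCombination (ZMod 2) φ

@[simp] theorem pair_single (φ : List X → ZMod 2) (l : List X) :
    pair φ (Finsupp.single l 1) = φ l := by
  simp [pair]

theorem pair_congr {φ ψ : List X → ZMod 2} {s : Set (List X)} (h : ∀ l ∈ s, φ l = ψ l)
    {c : ListChain X} (hc : c ∈ Finsupp.supported (ZMod 2) (ZMod 2) s) :
    pair φ c = pair ψ c := by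
  rw [pair, pair, Finsupp.linearCombination_apply, Finsupp.linearCombination_apply]
  exact Finset.sum_congr rfl fun l hl => congrArg (c l • ·) (h l (hc hl))

theorem pair_eq_zero {φ : List X → ZMod 2} {s : Set (List X)} (h : ∀ l ∈ s, φ l = 0)
    {c : ListChain X} (hc : c ∈ Finsupp.supported (ZMod 2) (ZMod 2) s) : pair φ c = 0 := by
  rw [pair_congr h hc, pair, Finsupp.linearCombination_apply]
  simp

variable {G : Type*} [Group G]

/-- Left translation of chains. -/
noncomputable def act (g : G) : ListChain G →ₗ[ZMod 2] ListChain G :=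
  Finsupp.lmapDomain _ _ (List.map (g * ·))

@[simp] theorem act_single (g : G) (l : List G) (a : ZMod 2) :
    act g (Finsupp.single l a) = Finsupp.single (l.map (g * ·)) a := by
  simp [act, Finsupp.mapDomain_single]

theorem act_cone (g x : G) (c : ListChain G) : act g (cone x c) = cone (g * x) (act g c) := by
  have : act g ∘ₗ cone x = cone (g * x) ∘ₗ act g := hom_ext fun l => by simp
  exact LinearMap.congr_fun this c

theorem bdry_act (g : G) (c : ListChain G) : bdry (act g c) = act g (bdry c) := by
  have : bdry ∘ₗ act g = act g ∘ₗ bdry := hom_ext fun l => by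
    induction l with
    | nil => simp
    | cons x l ih =>
      simp only [LinearMap.comp_apply, act_single] at ih
      simp only [LinearMap.comp_apply, act_single, List.map_cons]
      rw [bdry_cons, bdry_cons, map_add, act_cone, ih, act_single]
  exact LinearMap.congr_fun this c

theorem map_mul_map (g h : G) (l : List G) :
    (l.map (h * ·)).map (g * ·) = l.map (g * h * ·) := by
  simp [mul_assoc]

theorem act_mul (g h : G) (c : ListChain G) : act (g * h) c = act g (act h c) := by
  have : act (g * h) = act g ∘ₗ act h := hom_ext fun l => by
    rw [LinearMap.comp_apply, act_single, act_single, act_single, map_mul_map]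
  exact LinearMap.congr_fun this c

@[simp] theorem act_one (c : ListChain G) : act (1 : G) c = c := by
  have : act (1 : G) = LinearMap.id := hom_ext fun l => by simp
  exact LinearMap.congr_fun this c

theorem act_mem_homog {d : ℕ} (g : G) {c : ListChain G} (hc : c ∈ homog Set.univ d) :
    act g c ∈ homog Set.univ d := by
  refine map_mem_of_mem_supported (act g) _ (fun l hl => ?_) hc
  rw [act_single]
  exact single_mem_homog (by simpa using hl.1) (by simp) _

/-! ### Coinvariants -/

/-- The chains that vanish in the coinvariants of the subgroup `N`. -/
noncomputable def null (N : Subgroup G) : Submodule (ZMod 2) (ListChain G) :=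
  -- Killing the empty simplex undoes the augmentation, so that every combination of vertices is a
  -- cycle in the coinvariants.
  Submodule.span _ ({Finsupp.single [] 1} ∪
    {c | ∃ g ∈ N, ∃ l : List G,
      c = Finsupp.single (l.map (g * ·)) 1 + Finsupp.single l 1})

theorem nil_mem_null (N : Subgroup G) : Finsupp.single [] 1 ∈ null N :=
  Submodule.subset_span (Or.inl rfl)

theorem act_add_mem_null {N : Subgroup G} {g : G} (hg : g ∈ N) (c : ListChain G) :
    act g c + c ∈ null N := by
  refine map_mem_of_mem_supported (s := Set.univ) (act g + LinearMap.id) _ (fun l _ => ?_) (by simp)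
  exact Submodule.subset_span (Or.inr ⟨g, hg, l, by simp⟩)

theorem map_null_le {M : Type*} [AddCommGroup M] [Module (ZMod 2) M] {N : Subgroup G}
    {f : ListChain G →ₗ[ZMod 2] M} {P : Submodule (ZMod 2) M}
    (h0 : f (Finsupp.single [] 1) ∈ P)
    (h : ∀ g ∈ N, ∀ c, f (act g c + c) ∈ P) {c : ListChain G} (hc : c ∈ null N) : f c ∈ P := by
  have : null N ≤ P.comap f := by
    rw [null, Submodule.span_le]
    rintro _ (rfl | ⟨g, hg, l, rfl⟩)
    · exact h0
    · simpa using h g hg (Finsupp.single l 1)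
  exact this hc

theorem bdry_mem_null {N : Subgroup G} {c : ListChain G} (hc : c ∈ null N) : bdry c ∈ null N := by
  refine map_null_le (by simp) (fun g hg c => ?_) hc
  rw [map_add, bdry_act]
  exact act_add_mem_null hg _

theorem null_mono {N M : Subgroup G} (h : N ≤ M) : null N ≤ null M := fun _ hc =>
  map_null_le (f := LinearMap.id) (nil_mem_null M) (fun _ hg _ => act_add_mem_null (h hg) _) hc

theorem act_mem_null {N : Subgroup G} {t : G} (ht : ∀ n ∈ N, t * n * t⁻¹ ∈ N) {c : ListChain G}
    (hc : c ∈ null N) : act t c ∈ null N := by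
  refine map_null_le (by simpa using nil_mem_null N) (fun g hg c => ?_) hc
  have := act_add_mem_null (ht g hg) (act t c)
  rw [← act_mul] at this
  rwa [map_add, ← act_mul, show t * g = t * g * t⁻¹ * t by group]

end ListChain

/-! ### Extensions by an infinite cyclic group -/

/-- `M` is generated by its normal subgroup `N` and the element `t`. -/
structure IsCyclicExtension {G : Type*} [Group G] (N M : Subgroup G) (t : G) : Prop where
  conj_mem_iff : ∀ n, t * n * t⁻¹ ∈ N ↔ n ∈ N
  mem_iff : ∀ g, g ∈ M ↔ ∃ n ∈ N, ∃ k : ℤ, g = n * t ^ k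

/-- `M` is the semidirect product of `N` and the infinite cyclic group generated by `t`. -/
structure IsInfiniteCyclicExtension {G : Type*} [Group G] (N M : Subgroup G) (t : G) : Prop
    extends IsCyclicExtension N M t where
  eq_zero : ∀ k : ℤ, t ^ k ∈ N → k = 0

namespace IsCyclicExtension

variable {G : Type*} [Group G] {N M : Subgroup G} {t : G}

theorem _root_.Subgroup.zpow_conj_mem (h : ∀ n, t * n * t⁻¹ ∈ N ↔ n ∈ N) (k : ℤ) :
    ∀ n ∈ N, t ^ k * n * (t ^ k)⁻¹ ∈ N := by
  induction k with
  | zero => simp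
  | succ k ih =>
    intro n hn
    have := (h _).2 (ih n hn)
    rw [add_comm (k : ℤ) 1, zpow_add, zpow_one]
    simpa [mul_assoc] using this
  | pred k ih =>
    intro n hn
    refine (h _).1 ?_
    have := ih n hn
    have e : t ^ (-(k : ℤ) - 1) = t⁻¹ * t ^ (-(k : ℤ)) := by
      rw [sub_eq_add_neg, add_comm, zpow_add]; simp
    rw [e]
    simpa [mul_assoc] using this

theorem zpow_conj_mem (h : IsCyclicExtension N M t) (k : ℤ) :
    ∀ n ∈ N, t ^ k * n * (t ^ k)⁻¹ ∈ N :=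
  Subgroup.zpow_conj_mem h.conj_mem_iff k

theorem le (h : IsCyclicExtension N M t) : N ≤ M := fun n hn =>
  (h.mem_iff n).2 ⟨n, hn, 0, by simp⟩

theorem mem (h : IsCyclicExtension N M t) : t ∈ M :=
  (h.mem_iff t).2 ⟨1, one_mem N, 1, by simp⟩

end IsCyclicExtension

namespace IsInfiniteCyclicExtension

variable {G : Type*} [Group G] {N M : Subgroup G} {t : G}

theorem exponent_unique (h : IsInfiniteCyclicExtension N M t) {n n' : G} (hn : n ∈ N) (hn' : n' ∈ N)
    {k k' : ℤ} (e : n * t ^ k = n' * t ^ k') : k = k' := by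
  have : t ^ (k - k') ∈ N := by
    rw [zpow_sub]
    have : t ^ k * (t ^ k')⁻¹ = n⁻¹ * n' := by
      rw [eq_inv_mul_iff_mul_eq, ← mul_assoc, e, mul_assoc, mul_inv_cancel, mul_one]
    rw [this]
    exact mul_mem (inv_mem hn) hn'
  have := h.eq_zero _ this
  omega

/-- The coordinates on an infinite cyclic extension. -/
noncomputable def coord (h : IsInfiniteCyclicExtension N M t) : ℤ × N ≃ M :=
  Equiv.ofBijective (fun p => ⟨p.2 * t ^ p.1, (h.mem_iff _).2 ⟨_, p.2.2, _, rfl⟩⟩) <| by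
    constructor
    · rintro ⟨k, n⟩ ⟨k', n'⟩ e
      have e' : (n : G) * t ^ k = n' * t ^ k' := congrArg Subtype.val e
      obtain rfl := h.exponent_unique n.2 n'.2 e'
      have := mul_right_cancel e'
      exact Prod.ext rfl (Subtype.ext this)
    · rintro ⟨g, hg⟩
      obtain ⟨n, hn, k, rfl⟩ := (h.mem_iff g).1 hg
      exact ⟨⟨k, n, hn⟩, rfl⟩

/-- The height is the exponent of `t` relative to a chosen representative of the coset `M x`. It is
needed on all of `G`, since the vertices of simplices need not lie in `M`. -/
theorem exists_height (h : IsInfiniteCyclicExtension N M t) :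
    ∃ q : G → ℤ, q 1 = 0 ∧ (∀ n ∈ N, ∀ x, q (n * x) = q x) ∧
      ∀ (k : ℤ) x, q (t ^ k * x) = q x + k := by
  let r : G → G := fun x => (Quotient.mk (QuotientGroup.rightRel M) x).out
  have hr : ∀ x, x * (r x)⁻¹ ∈ M := fun x =>
    QuotientGroup.rightRel_apply.1 (Quotient.mk_out (s := QuotientGroup.rightRel M) x)
  have hrm : ∀ g ∈ M, ∀ x, r (g * x) = r x := fun g hg x => by
    refine congrArg Quotient.out (Quotient.sound ?_)
    refine QuotientGroup.rightRel_apply.2 ?_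
    simpa using hg
  have : ∀ x, ∃ k : ℤ, ∃ n ∈ N, x * (r x)⁻¹ = n * t ^ k := fun x => by
    obtain ⟨n, hn, k, e⟩ := (h.mem_iff _).1 (hr x)
    exact ⟨k, n, hn, e⟩
  choose q n hn e using this
  have hq : ∀ m ∈ N, ∀ (k : ℤ) x, q (m * t ^ k * x) = q x + k := fun m hm k x => by
    have e' := e (m * t ^ k * x)
    rw [hrm _ ((h.mem_iff _).2 ⟨m, hm, k, rfl⟩), mul_assoc, e x, mul_assoc, ← mul_assoc (t ^ k),
      ← mul_inv_cancel_right (t ^ k * n x) (t ^ k)⁻¹, inv_inv, mul_assoc _ _ (t ^ q x), ← zpow_add,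
      ← mul_assoc] at e'
    have := h.exponent_unique (mul_mem hm (h.zpow_conj_mem k _ (hn x))) (hn _) e'
    omega
  refine ⟨fun x => q x - q 1, sub_self _, fun n hn x => ?_, fun k x => ?_⟩
  · simpa using hq n hn 0 x
  · have := hq 1 (one_mem N) k x
    rw [one_mul] at this
    simp only [this]
    ring

end IsInfiniteCyclicExtension

/-! ### Coinvariants of an infinite cyclic extension -/

namespace ListChain

variable {G : Type*} [Group G] {N M : Subgroup G} {t : G}

/-- The orbit relation of a subgroup acting on lists by left translation. -/
def orbitSetoid (N : Subgroup G) : Setoid (List G) where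
  r l l' := ∃ g ∈ N, l' = l.map (g * ·)
  iseqv :=
    { refl := fun l => ⟨1, one_mem N, by simp⟩
      symm := by
        rintro l _ ⟨g, hg, rfl⟩
        exact ⟨g⁻¹, inv_mem hg, by rw [map_mul_map]; simp⟩
      trans := by
        rintro l _ _ ⟨g, hg, rfl⟩ ⟨g', hg', rfl⟩
        exact ⟨g' * g, mul_mem hg' hg, by rw [map_mul_map]⟩ }

/-- The projection of chains to the coinvariants. -/
noncomputable def toOrbits (N : Subgroup G) :
    ListChain G →ₗ[ZMod 2] (Quotient (orbitSetoid N) →₀ ZMod 2) :=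
  Finsupp.lmapDomain _ _ (Quotient.mk (orbitSetoid N))

theorem toOrbits_single (N : Subgroup G) (l : List G) :
    toOrbits N (Finsupp.single l 1) = Finsupp.single (Quotient.mk (orbitSetoid N) l) 1 := by
  simp [toOrbits, Finsupp.mapDomain_single]

/-- Choosing a representative in each orbit splits the projection, and a simplex differs from the
chosen one by a generator of `null N`. -/
theorem mem_null_of_toOrbits_eq_zero {c : ListChain G} (hc : toOrbits N c = 0) : c ∈ null N := by
  let s := Finsupp.lmapDomain (ZMod 2) (ZMod 2) (Quotient.out (s := orbitSetoid N))
  have : ∀ c : ListChain G, s (toOrbits N c) + c ∈ null N := fun c => by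
    refine map_mem_of_mem_supported (s := Set.univ) (s ∘ₗ toOrbits N + LinearMap.id) _
      (fun l _ => ?_) (by simp)
    obtain ⟨g, hg, e⟩ := (orbitSetoid N).symm (Quotient.mk_out (s := orbitSetoid N) l)
    refine Submodule.subset_span (Or.inr ⟨g, hg, l, ?_⟩)
    simp only [LinearMap.add_apply, LinearMap.comp_apply, toOrbits_single, LinearMap.id_apply]
    rw [← e]
    simp [s, Finsupp.mapDomain_single]
  simpa [hc] using this c

theorem toOrbits_apply_eq_zero {c : ListChain G} (hc : c ∈ null N) {l : List G} (hl : l ≠ []) :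
    toOrbits N c (Quotient.mk _ l) = 0 := by
  refine map_null_le (f := Finsupp.lapply (Quotient.mk _ l) ∘ₗ toOrbits N) (P := ⊥) ?_ ?_ hc
  · simp only [Submodule.mem_bot, LinearMap.comp_apply, toOrbits_single, Finsupp.lapply_apply]
    refine Finsupp.single_eq_of_ne fun e => hl ?_
    obtain ⟨g, -, e⟩ := Quotient.exact e
    simpa using e.symm
  · intro g hg c
    have : toOrbits N ∘ₗ act g = toOrbits N := hom_ext fun l => by
      rw [LinearMap.comp_apply, act_single, toOrbits_single, toOrbits_single]
      congr 1
      exact Quotient.sound ((orbitSetoid N).symm ⟨g, hg, rfl⟩)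
    have e := LinearMap.congr_fun this c
    rw [LinearMap.comp_apply] at e
    simp only [LinearMap.comp_apply, map_add, e, Submodule.mem_bot]
    exact ZModModule.add_self _

/-- The generator of an infinite cyclic extension acts injectively on coinvariants, minus one. -/
theorem mem_null_of_act_add_mem_null (h : IsInfiniteCyclicExtension N M t) {d : ℕ}
    {c : ListChain G} (hc : c ∈ homog Set.univ (d + 1)) (ht : act t c + c ∈ null N) :
    c ∈ null N := by
  apply mem_null_of_toOrbits_eq_zero
  by_contra hne
  have hnil : toOrbits N c (Quotient.mk _ []) = 0 := by
    refine map_mem_of_mem_supported (Finsupp.lapply _ ∘ₗ toOrbits N) ⊥ (fun l hl => ?_) hc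
    simp only [Submodule.mem_bot, LinearMap.comp_apply, toOrbits_single, Finsupp.lapply_apply]
    refine Finsupp.single_eq_of_ne fun e => ?_
    obtain ⟨g, -, e⟩ := Quotient.exact e
    simp only [List.map_nil] at e
    simp_all
  -- Since `t` normalizes `N`, it permutes the `N`-orbits of simplices.
  let τ : Quotient (orbitSetoid N) → Quotient (orbitSetoid N) :=
    Quotient.map (List.map (t * ·)) <| by
      rintro l _ ⟨g, hg, rfl⟩
      exact ⟨t * g * t⁻¹, (h.conj_mem_iff g).2 hg, by simp [mul_assoc]⟩
  have hτ : Function.Injective τ := by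
    rintro ⟨l⟩ ⟨l'⟩ e
    obtain ⟨g, hg, e⟩ := Quotient.exact e
    refine Quotient.sound ⟨t⁻¹ * g * t, (h.conj_mem_iff _).1 (by simpa [mul_assoc] using hg), ?_⟩
    have := congrArg (List.map (t⁻¹ * ·)) e
    simpa [map_mul_map, mul_assoc, Function.comp_def] using this
  have hact : toOrbits N (act t c) = Finsupp.mapDomain τ (toOrbits N c) := by
    have : toOrbits N ∘ₗ act t = Finsupp.lmapDomain _ _ τ ∘ₗ toOrbits N := hom_ext fun l => by
      simp only [LinearMap.comp_apply, act_single, toOrbits_single, Finsupp.lmapDomain_apply,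
        Finsupp.mapDomain_single]
      rfl
    exact LinearMap.congr_fun this c
  have hinv : ∀ l : List G, l ≠ [] → toOrbits N c (Quotient.mk _ (l.map (t * ·))) =
      toOrbits N c (Quotient.mk _ l) := fun l hl => by
    have h1 := toOrbits_apply_eq_zero ht (l := l.map (t * ·)) (by simpa using hl)
    have h2 : Quotient.mk (orbitSetoid N) (l.map (t * ·)) = τ (Quotient.mk _ l) := rfl
    rw [map_add, Finsupp.add_apply, hact, h2, Finsupp.mapDomain_apply hτ] at h1
    rw [h2, ← ZModModule.neg_eq_self (toOrbits N c (τ _))]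
    exact (eq_neg_of_add_eq_zero_left h1).symm
  obtain ⟨o, hl⟩ := Finsupp.support_nonempty_iff.2 hne
  obtain ⟨l, rfl⟩ := Quotient.exists_rep o
  rw [Finsupp.mem_support_iff] at hl
  cases l with
  | nil => exact hl hnil
  | cons x l =>
    -- Invariance puts all translates by powers of `t` in the finite support. They are distinct
    -- orbits, because a coincidence, read on the first vertex, forces the two exponents to agree.
    have hpow : ∀ k : ℕ, Quotient.mk _ ((x :: l).map (t ^ k * ·)) ∈ (toOrbits N c).support := by
      intro k
      rw [Finsupp.mem_support_iff]
      induction k with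
      | zero => simpa using hl
      | succ k ih =>
        rw [pow_succ', ← map_mul_map, hinv _ (by simp)]
        exact ih
    refine Set.infinite_of_injective_forall_mem (fun k k' e => ?_) hpow
      (Finset.finite_toSet (toOrbits N c).support)
    obtain ⟨g, hg, e⟩ := Quotient.exact e
    simp only [List.map_cons, List.cons.injEq] at e
    have e' : 1 * t ^ (k' : ℤ) = g * t ^ (k : ℤ) := by
      have := e.1
      rw [← mul_assoc] at this
      simpa using mul_right_cancel this
    exact_mod_cast (h.exponent_unique (one_mem N) hg e').symm

/-- Chains that vanish in the coinvariants of an infinite cyclic extension of `N`. -/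
theorem exists_act_add_of_mem_null (h : IsInfiniteCyclicExtension N M t) {c : ListChain G}
    (hc : c ∈ null M) : ∃ v, c + (act t v + v) ∈ null N := by
  -- A telescoping sum: `t ^ k - 1` is divisible by `t - 1`.
  have hpow : ∀ (k : ℤ) (c : ListChain G), ∃ v, act (t ^ k) c + c + (act t v + v) ∈ null N := by
    intro k
    induction k with
    | zero =>
      intro c
      exact ⟨0, by simp [ZModModule.add_self]⟩
    | succ k ih =>
      intro c
      obtain ⟨v, hv⟩ := ih c
      refine ⟨v + act (t ^ (k : ℤ)) c, ?_⟩
      convert hv using 1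
      rw [add_comm (k : ℤ) 1, zpow_add, zpow_one, act_mul, map_add]
      rw [← add_zero (act (t ^ (k : ℤ)) c + c + _),
        ← ZModModule.add_self (act t (act (t ^ (k : ℤ)) c))]
      abel
    | pred k ih =>
      intro c
      obtain ⟨v, hv⟩ := ih c
      refine ⟨v + act (t ^ (-(k : ℤ) - 1)) c, ?_⟩
      convert hv using 1
      have e : t ^ (-(k : ℤ)) = t * t ^ (-(k : ℤ) - 1) := by
        rw [← zpow_one_add]; congr 1; ring
      rw [e, act_mul, map_add]
      rw [← add_zero (act t _ + c + _), ← ZModModule.add_self (act (t ^ (-(k : ℤ) - 1)) c)]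
      abel
  let P : Submodule (ZMod 2) (ListChain G) :=
    null N ⊔ LinearMap.range (act t + LinearMap.id)
  have : c ∈ P := by
    refine map_null_le (f := LinearMap.id) (Submodule.mem_sup_left (nil_mem_null N)) ?_ hc
    intro g hg c
    obtain ⟨n, hn, k, rfl⟩ := (h.mem_iff g).1 hg
    obtain ⟨v, hv⟩ := hpow k c
    have e : act (n * t ^ k) c + c =
        (act n (act (t ^ k) c) + act (t ^ k) c) + (act (t ^ k) c + c + (act t v + v))
          + (act t v + v) := by
      rw [act_mul]
      generalize act (t ^ k) c = b
      generalize act t v + v = w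
      rw [show act n b + b + (b + c + w) + w = act n b + c + (b + b) + (w + w) by abel,
        ZModModule.add_self, ZModModule.add_self, add_zero, add_zero]
    rw [LinearMap.id_apply, e]
    exact add_mem (Submodule.mem_sup_left (add_mem (act_add_mem_null hn _) hv))
      (Submodule.mem_sup_right ⟨v, rfl⟩)
  obtain ⟨u, hu, _, ⟨v, rfl⟩, rfl⟩ := Submodule.mem_sup.1 this
  refine ⟨v, ?_⟩
  simpa [add_assoc, ZModModule.add_self] using hu

/-- The projection to the chains spanned by simplices with `d` vertices. -/
noncomputable def proj {X : Type*} (d : ℕ) : ListChain X →ₗ[ZMod 2] ListChain X :=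
  Finsupp.linearCombination _ fun l => if l.length = d then Finsupp.single l 1 else 0

theorem proj_single {X : Type*} (d : ℕ) (l : List X) :
    proj d (Finsupp.single l 1) = if l.length = d then Finsupp.single l 1 else 0 := by
  simp [proj]

theorem proj_mem_homog {X : Type*} (d : ℕ) (c : ListChain X) : proj d c ∈ homog Set.univ d := by
  refine map_mem_of_mem_supported (s := Set.univ) (proj d) _ (fun l _ => ?_) (by simp)
  rw [proj_single]
  split_ifs with hl
  · exact single_mem_homog hl (by simp) _
  · exact zero_mem _

theorem proj_eq_self {X : Type*} {d : ℕ} {c : ListChain X} (hc : c ∈ homog Set.univ d) : proj d c = c := by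
  have := map_mem_of_mem_supported (proj d + LinearMap.id) ⊥ (fun l hl => ?_) hc
  · exact (eq_neg_of_add_eq_zero_left this).trans (ZModModule.neg_eq_self c)
  · simp only [LinearMap.add_apply, proj_single, if_pos hl.1, LinearMap.id_apply]
    exact ZModModule.add_self _

theorem proj_act (d : ℕ) (g : G) (c : ListChain G) : proj d (act g c) = act g (proj d c) := by
  have : proj d ∘ₗ act g = act g ∘ₗ proj d := hom_ext fun l => by
    simp only [LinearMap.comp_apply, act_single, proj_single, List.length_map]
    split_ifs <;> simp
  exact LinearMap.congr_fun this c

theorem proj_mem_null (d : ℕ) {c : ListChain G} (hc : c ∈ null N) : proj d c ∈ null N := by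
  refine map_null_le ?_ (fun g hg c => ?_) hc
  · rw [proj_single]
    split_ifs
    · exact nil_mem_null N
    · exact zero_mem _
  · rw [map_add, proj_act]
    exact act_add_mem_null hg _

theorem exists_homog_act_add_of_mem_null (h : IsInfiniteCyclicExtension N M t) {d : ℕ}
    {c : ListChain G} (hd : c ∈ homog Set.univ d) (hc : c ∈ null M) :
    ∃ v ∈ homog Set.univ d, c + (act t v + v) ∈ null N := by
  obtain ⟨v, hv⟩ := exists_act_add_of_mem_null h hc
  refine ⟨proj d v, proj_mem_homog d v, ?_⟩
  have := proj_mem_null d hv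
  rwa [map_add, map_add, proj_act, proj_eq_self hd] at this

end ListChain

namespace ListChain

variable {G : Type*} [Group G] {N M : Subgroup G} {t : G}

/-! ### Sums of cochains over orbits -/

/-- The simplicial coboundary of a cochain. -/
noncomputable def coboundary {X : Type*} (f : List X → ZMod 2) (l : List X) : ZMod 2 :=
  pair f (bdry (Finsupp.single l 1))

theorem pair_coboundary {X : Type*} (f : List X → ZMod 2) (c : ListChain X) :
    pair (coboundary f) c = pair f (bdry c) := by
  have : pair (coboundary f) = pair f ∘ₗ bdry := hom_ext fun l => by simp [coboundary]
  exact LinearMap.congr_fun this c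

/-- A cochain vanishes on all but finitely many translates of every simplex. -/
def IsLocallyFinite (N : Subgroup G) (f : List G → ZMod 2) : Prop :=
  ∀ l : List G, (Function.support fun g : N => f (l.map ((g : G) * ·))).Finite

theorem IsLocallyFinite.support_finite {f : List G → ZMod 2} (hf : IsLocallyFinite N f)
    (c : ListChain G) : (Function.support fun g : N => pair f (act (g : G) c)).Finite := by
  induction c using Finsupp.induction_linear with
  | zero => simp
  | add c c' hc hc' =>
    refine (hc.union hc').subset ?_
    simp only [map_add]
    exact Function.support_add _ _
  | single l a =>
    obtain rfl | rfl := eq_zero_or_one a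
    · simp
    · simpa using hf l

/-- The sum of the values of a cochain over the translates of a chain. -/
noncomputable def orbitSum (N : Subgroup G) (f : List G → ZMod 2) : ListChain G →ₗ[ZMod 2] ZMod 2 :=
  pair fun l => ∑ᶠ g : N, f (l.map ((g : G) * ·))

/-- Local finiteness lets the sum over `N` commute with linear combinations; an infinite support
would make the `finsum` zero by convention. -/
theorem orbitSum_eq_finsum {f : List G → ZMod 2} (hf : IsLocallyFinite N f) (c : ListChain G) :
    orbitSum N f c = ∑ᶠ g : N, pair f (act (g : G) c) := by
  induction c using Finsupp.induction_linear with
  | zero => simp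
  | add c c' hc hc' =>
    simp only [map_add]
    rw [finsum_add_distrib (hf.support_finite c) (hf.support_finite c'), hc, hc']
  | single l a =>
    obtain rfl | rfl := eq_zero_or_one a
    · simp
    · simp [orbitSum]

theorem orbitSum_act {f : List G → ZMod 2} {g : G} (hg : g ∈ N) (c : ListChain G) :
    orbitSum N f (act g c) = orbitSum N f c := by
  have : orbitSum N f ∘ₗ act g = orbitSum N f := hom_ext fun l => by
    simp only [LinearMap.comp_apply, act_single, orbitSum, pair_single, map_mul_map]
    exact finsum_comp_equiv (Equiv.mulRight (⟨g, hg⟩ : N))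
      (f := fun x : N => f (l.map ((x : G) * ·)))
  exact LinearMap.congr_fun this c

theorem orbitSum_eq_zero_of_mem_null {f : List G → ZMod 2} (hf : f [] = 0) {c : ListChain G}
    (hc : c ∈ null N) : orbitSum N f c = 0 := by
  refine map_null_le (P := ⊥) ?_ (fun g hg c => ?_) hc
  · simp [orbitSum, hf]
  · rw [map_add, orbitSum_act hg, Submodule.mem_bot]
    exact ZModModule.add_self _

theorem IsLocallyFinite.coboundary {f : List G → ZMod 2} (hf : IsLocallyFinite N f) :
    IsLocallyFinite N (coboundary f) := fun l => by
  have := hf.support_finite (bdry (Finsupp.single l 1))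
  simpa only [← bdry_act, act_single, ListChain.coboundary] using this

theorem orbitSum_coboundary {f : List G → ZMod 2} (hf : IsLocallyFinite N f) (c : ListChain G) :
    orbitSum N (coboundary f) c = orbitSum N f (bdry c) := by
  rw [orbitSum_eq_finsum hf.coboundary, orbitSum_eq_finsum hf]
  simp only [pair_coboundary, bdry_act]

/-! ### Top classes -/

/-- A chain that bounds in the coinvariants of `N`. -/
def Bounds (N : Subgroup G) (d : ℕ) (w : ListChain G) : Prop :=
  ∃ b ∈ homog Set.univ (d + 1), w + bdry b ∈ null N

/-- The homology of `N` modulo two vanishes above degree `m`, and in degree `m` it is generated by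
a class that a locally finite cocycle detects. -/
structure HasTopClass (N : Subgroup G) (m : ℕ) : Prop where
  vanishing : ∀ d, m + 1 < d → ∀ w ∈ homog Set.univ d, bdry w ∈ null N → Bounds N d w
  unique : ∀ w ∈ homog Set.univ (m + 1), ∀ w' ∈ homog Set.univ (m + 1),
    bdry w ∈ null N → bdry w' ∈ null N → ¬ Bounds N (m + 1) w → ¬ Bounds N (m + 1) w' →
      Bounds N (m + 1) (w + w')
  detected : ∃ φ : List G → ZMod 2, (∀ l, l.length ≠ m + 1 → φ l = 0) ∧ (∀ l, coboundary φ l = 0) ∧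
    IsLocallyFinite N φ ∧ ∃ z ∈ homog Set.univ (m + 1), bdry z ∈ null N ∧ orbitSum N φ z = 1

theorem orbitSum_eq_zero_of_bounds {φ : List G → ZMod 2} (h0 : φ [] = 0)
    (hφ : ∀ l, coboundary φ l = 0) (hf : IsLocallyFinite N φ) {d : ℕ} {w : ListChain G}
    (hw : Bounds N d w) : orbitSum N φ w = 0 := by
  obtain ⟨b, -, hb⟩ := hw
  have h1 := orbitSum_eq_zero_of_mem_null h0 hb
  have h2 : orbitSum N φ (bdry b) = 0 := by
    rw [← orbitSum_coboundary hf, show coboundary φ = fun _ => 0 from funext hφ]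
    simp [orbitSum, pair, Finsupp.linearCombination_apply]
  rwa [map_add, h2, add_zero] at h1

/-- The homology of a point: coning contracts the complex, and the cocycle equal to 1 on each vertex
detects a single vertex. -/
theorem hasTopClass_bot : HasTopClass (⊥ : Subgroup G) 0 := by
  have hfill : ∀ {d : ℕ} {w : ListChain G}, w ∈ homog Set.univ d → bdry w = 0 →
      Bounds (⊥ : Subgroup G) d w := fun {d w} hw h =>
    ⟨cone 1 w, cone_mem_homog (Set.mem_univ _) hw, by
      rw [bdry_cone, h, map_zero, add_zero, ZModModule.add_self]; exact zero_mem _⟩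
  have hnull : ∀ c ∈ null (⊥ : Subgroup G), ∀ l ≠ [], c l = 0 := fun c hc l hl => by
    refine map_null_le (f := Finsupp.lapply l) (P := ⊥) ?_ (fun g hg c => ?_) hc
    · simpa using Finsupp.single_eq_of_ne (by simpa using hl)
    · rw [Subgroup.mem_bot.1 hg, act_one, ZModModule.add_self]
      exact zero_mem _
  have hcount : ∀ w : ListChain G, w ∈ homog Set.univ (0 + 1) →
      ¬ Bounds (⊥ : Subgroup G) (0 + 1) w → bdry w = Finsupp.single [] 1 := fun w hw h => by
    have h1 := homog_zero (bdry_mem_homog hw)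
    generalize bdry w [] = a at h1
    obtain rfl | rfl := eq_zero_or_one a
    · exact absurd (hfill hw (by simpa using h1)) h
    · exact h1
  refine ⟨fun d hd w hw h => hfill hw ?_, fun w hw w' hw' _ _ hb hb' => ?_, ?_⟩
  -- The boundary of a chain of simplices with at least two vertices has no empty simplex, and
  -- nothing else is null for the trivial group.
  · obtain ⟨d, rfl⟩ : ∃ e, d = e + 1 + 1 := ⟨d - 2, by omega⟩
    ext l
    by_cases hl : l = []
    · refine Finsupp.notMem_support_iff.1 fun h' => ?_
      have := (bdry_mem_homog hw h').1
      simp [hl] at this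
    · exact hnull _ h l hl
  · refine hfill (add_mem hw hw') ?_
    rw [map_add, hcount w hw hb, hcount w' hw' hb', ZModModule.add_self]
  · refine ⟨fun l => if l.length = 1 then 1 else 0, fun l hl => if_neg hl, fun l => ?_,
      fun l => Set.toFinite _, Finsupp.single [1] 1, single_mem_homog rfl (by simp) _, ?_, ?_⟩
    · rcases l with _ | ⟨x, _ | ⟨y, _ | ⟨z, l⟩⟩⟩
      · simp [coboundary]
      · simp [coboundary, bdry_cons]
      · simp only [coboundary, bdry_cons, bdry_nil, map_zero, map_add, cone_single, pair_single,
          add_zero]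
        simpa using ZModModule.add_self (1 : ZMod 2)
      · refine pair_eq_zero (s := {l | l.length ≠ 1}) (fun l hl => if_neg hl) ?_
        have : bdry (Finsupp.single (x :: y :: z :: l) 1) ∈
            homog (Set.univ : Set G) (l.length + 2) :=
          bdry_mem_homog (single_mem_homog (by simp) (by simp) _)
        exact Finsupp.supported_mono (fun l' hl' => by simp [hl'.1]) this
    · rw [bdry_cons]
      simpa using nil_mem_null _
    · simp only [orbitSum, pair_single]
      rw [finsum_eq_single _ 1 fun g hg => absurd (Subsingleton.elim g 1) hg]
      simp

/-- Translation by `t ^ k` preserves `null N`, so the translate of `z` is again a nonbounding cycle.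
By uniqueness it is homologous to `z`, and `φ` sums to the same value. -/
theorem HasTopClass.detected_act {m : ℕ} (hN : HasTopClass N m)
    (h : IsInfiniteCyclicExtension N M t) {φ : List G → ZMod 2} (h0 : φ [] = 0)
    (hφ : ∀ l, coboundary φ l = 0) (hf : IsLocallyFinite N φ) {z : ListChain G}
    (hz : z ∈ homog Set.univ (m + 1)) (hzN : bdry z ∈ null N) (hz1 : orbitSum N φ z = 1) (k : ℤ) :
    ¬ Bounds N (m + 1) (act (t ^ k) z) ∧ orbitSum N φ (act (t ^ k) z) = 1 := by
  have hb : ∀ w, Bounds N (m + 1) w → orbitSum N φ w = 0 := fun w hw =>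
    orbitSum_eq_zero_of_bounds h0 hφ hf hw
  have hz0 : ¬ Bounds N (m + 1) z := fun hw => by
    rw [hb z hw] at hz1; exact zero_ne_one hz1
  have hk : ¬ Bounds N (m + 1) (act (t ^ k) z) := by
    rintro ⟨b, hb, hw⟩
    refine hz0 ⟨act (t ^ (-k)) b, act_mem_homog _ hb, ?_⟩
    have := act_mem_null (h.zpow_conj_mem (-k)) hw
    rwa [map_add, ← act_mul, ← zpow_add, neg_add_cancel, zpow_zero, act_one, ← bdry_act] at this
  refine ⟨hk, ?_⟩
  have := hb _ (hN.unique _ hz _ (act_mem_homog (t ^ k) hz) hzN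
    (by rw [bdry_act]; exact act_mem_null (h.zpow_conj_mem k) hzN) hz0 hk)
  rw [map_add, hz1] at this
  generalize orbitSum N φ (act (t ^ k) z) = a at this
  revert a
  decide

end ListChain

namespace ListChain

variable {G : Type*} [Group G] {N M : Subgroup G} {t : G}

/-! ### The top class of an infinite cyclic extension -/

/-- The connecting map of the Wang sequence, which comes from multiplication by `t - 1` on the
coinvariants of `N`, with quotient the coinvariants of `M`. That `v` is a cycle follows from the
injectivity of `t - 1`. -/
theorem exists_connecting (h : IsInfiniteCyclicExtension N M t) {d : ℕ} {w : ListChain G}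
    (hw : w ∈ homog Set.univ (d + 2)) (hwM : bdry w ∈ null M) :
    ∃ v ∈ homog Set.univ (d + 1), bdry v ∈ null N ∧ bdry w + (act t v + v) ∈ null N := by
  obtain ⟨v, hv, hwv⟩ := exists_homog_act_add_of_mem_null h (bdry_mem_homog hw) hwM
  refine ⟨v, hv, ?_, hwv⟩
  have hd := bdry_mem_homog hv
  cases d with
  | zero =>
    rw [homog_zero hd, ← mul_one (bdry v []), ← smul_eq_mul, ← Finsupp.smul_single]
    exact Submodule.smul_mem _ _ (nil_mem_null N)
  | succ d =>
    refine mem_null_of_act_add_mem_null h hd ?_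
    have := bdry_mem_null hwv
    rwa [map_add, bdry_bdry, zero_add, map_add, bdry_act] at this

/-- Exactness: if `b` fills `v`, then adding `(t + 1) b` to `w` gives a cycle over `N`, and the
added term vanishes over `M`. -/
theorem exists_of_bounds_connecting (h : IsInfiniteCyclicExtension N M t) {d : ℕ}
    {v w : ListChain G} (hw : w ∈ homog Set.univ (d + 1))
    (hwv : bdry w + (act t v + v) ∈ null N) (hv : Bounds N d v) :
    ∃ w' ∈ homog Set.univ (d + 1), bdry w' ∈ null N ∧ w + w' ∈ null M := by
  obtain ⟨b, hb, hbv⟩ := hv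
  refine ⟨w + (act t b + b), add_mem hw (add_mem (act_mem_homog t hb) hb), ?_, ?_⟩
  · have := add_mem hwv (add_mem (act_mem_null (fun n hn => (h.conj_mem_iff n).2 hn) hbv) hbv)
    rw [map_add, map_add, bdry_act]
    convert this using 1
    rw [map_add, show bdry w + (act t v + v) + (act t v + act t (bdry b) + (v + bdry b)) =
      bdry w + (act t (bdry b) + bdry b) + (act t v + act t v) + (v + v) by abel,
      ZModModule.add_self, ZModModule.add_self, add_zero, add_zero]
  · rw [← add_assoc, ZModModule.add_self, zero_add]
    exact act_add_mem_null h.mem b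

theorem Bounds.of_add_mem_null (hNM : N ≤ M) {d : ℕ} {w w' : ListChain G} (hw' : Bounds N d w')
    (hw : w + w' ∈ null M) : Bounds M d w := by
  obtain ⟨b, hb, h⟩ := hw'
  refine ⟨b, hb, ?_⟩
  convert add_mem hw (null_mono hNM h) using 1
  rw [show w + w' + (w' + bdry b) = w + bdry b + (w' + w') by abel, ZModModule.add_self, add_zero]

/-- A telescoping sum. `T` itself may have infinite support; it becomes finitely supported after
adding the indicator of the negative integers, whose only jump, at -1, is the result. -/
theorem finsum_add_shift {T : ℤ → ZMod 2} {K : ℤ} (h0 : ∀ k, K ≤ k → T k = 0)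
    (h1 : ∀ k, k ≤ -K → T k = 1) : ∑ᶠ k, (T k + T (k + 1)) = 1 := by
  let s : ℤ → ZMod 2 := fun k => T k + if k < 0 then 1 else 0
  have hs : s.support.Finite := by
    refine (Set.finite_Icc (-|K|) |K|).subset fun k hk => ?_
    by_contra hk'
    refine hk ?_
    rw [Set.mem_Icc, not_and_or, not_le, not_le] at hk'
    have := neg_abs_le K
    have := le_abs_self K
    have := abs_nonneg K
    rcases hk' with hk' | hk'
    · simp only [s, h1 k (by omega), if_pos (show k < 0 by omega)]
      decide
    · simp [s, h0 k (by omega), if_neg (show ¬ k < 0 by omega)]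
  have hs' : (Function.support fun k => s (k + 1)).Finite :=
    (hs.preimage (f := fun k => k + 1) (add_left_injective 1).injOn)
  have hshift : ∑ᶠ k, s (k + 1) = ∑ᶠ k, s k := finsum_comp_equiv (Equiv.addRight (1 : ℤ))
  have hT : ∀ k, T k + T (k + 1) = (s k + s (k + 1)) + if k = -1 then 1 else 0 := fun k => by
    simp only [s]
    rcases lt_trichotomy k (-1) with hk | rfl | hk
    · rw [if_pos (by omega), if_pos (by omega), if_neg (by omega)]
      generalize T k = a, T (k + 1) = b
      revert a b
      decide
    · norm_num
      generalize T (-1) = a, T 0 = b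
      revert a b
      decide
    · rw [if_neg (by omega), if_neg (by omega), if_neg (by omega)]
      simp
  have hδ : (Function.support fun k : ℤ => if k = -1 then (1 : ZMod 2) else 0).Finite :=
    (Set.finite_singleton (-1)).subset fun k hk => by
      by_contra hk'
      exact hk (if_neg hk')
  simp only [hT]
  rw [finsum_add_distrib ((hs.union hs').subset (Function.support_add _ _)) hδ,
    finsum_add_distrib hs hs', hshift, ZModModule.add_self, zero_add,
    finsum_eq_single _ (-1) fun k hk => if_neg hk, if_pos rfl]

/-- The product of a cochain with a function of the first vertex. -/
def headMul {X : Type*} (θ : X → ZMod 2) (φ : List X → ZMod 2) : List X → ZMod 2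
  | [] => 0
  | x :: l => θ x * φ (x :: l)

theorem headMul_eq_zero {X : Type*} (θ : X → ZMod 2) {φ : List X → ZMod 2} {l : List X}
    (h : φ l = 0) : headMul θ φ l = 0 := by
  cases l with
  | nil => rfl
  | cons x l => simp [headMul, h]

/-- The cup product of the coboundary of `θ` with `φ`. The faces containing `y` contribute `θ y`
times their `φ`-sum, which is `φ (x :: l)` by the cocycle condition. -/
theorem coboundary_headMul {X : Type*} (θ : X → ZMod 2) {φ : List X → ZMod 2}
    (hφ : ∀ l, coboundary φ l = 0) (x y : X) (l : List X) :
    coboundary (headMul θ φ) (y :: x :: l) = (θ x + θ y) * φ (x :: l) := by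
  have h1 : pair (headMul θ φ) ∘ₗ cone y = θ y • (pair φ ∘ₗ cone y) := hom_ext fun l => by
    simp [headMul]
  have h2 := LinearMap.congr_fun h1 (bdry (Finsupp.single (x :: l) 1))
  have h3 := hφ (y :: x :: l)
  rw [coboundary, bdry_cons, map_add, pair_single] at h3 ⊢
  simp only [LinearMap.comp_apply, LinearMap.smul_apply, smul_eq_mul] at h2
  rw [h2, headMul, add_mul]
  congr 2
  rw [← ZModModule.neg_eq_self (φ (x :: l))]
  exact eq_neg_of_add_eq_zero_right h3

theorem IsLocallyFinite.headMul {φ : List G → ZMod 2} (hφ : IsLocallyFinite N φ)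
    (θ : G → ZMod 2) : IsLocallyFinite N (headMul θ φ) := fun l =>
  (hφ l).subset fun _ hg h => hg (headMul_eq_zero θ h)

/-- The factor from `θ` vanishes unless 0 separates the heights of the first two vertices. This
leaves finitely many powers of `t`, and for each of them `φ` is finite along `N`. -/
theorem isLocallyFinite_coboundary_headMul (h : IsInfiniteCyclicExtension N M t) {q : G → ℤ}
    (hqN : ∀ n ∈ N, ∀ x, q (n * x) = q x) (hqt : ∀ (k : ℤ) x, q (t ^ k * x) = q x + k)
    {φ : List G → ZMod 2} (hφ : ∀ l, coboundary φ l = 0) (hf : IsLocallyFinite N φ) :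
    IsLocallyFinite M (coboundary (headMul (fun x => if q x < 0 then 1 else 0) φ)) := by
  rintro (_ | ⟨y, _ | ⟨x, l⟩⟩)
  · convert Set.finite_empty
    simp [coboundary]
  · convert Set.finite_empty
    simp [coboundary, bdry_cons, headMul]
  · have hfin : (⋃ k ∈ Set.Icc (-|q x| - |q y|) (|q x| + |q y|), (fun n : N => h.coord (k, n)) ''
        (Function.support fun n : N =>
          φ (((x :: l).map (t ^ k * ·)).map ((n : G) * ·)))).Finite :=
      (Set.finite_Icc _ _).biUnion fun k _ => (hf _).image _
    refine hfin.subset fun g hg => ?_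
    obtain ⟨⟨k, n⟩, rfl⟩ := h.coord.surjective g
    have e : ((h.coord (k, n) : M) : G) = n * t ^ k := rfl
    rw [Function.mem_support, List.map_cons, List.map_cons, coboundary_headMul _ hφ, e, mul_assoc,
      mul_assoc, hqN _ n.2, hqN _ n.2, hqt, hqt] at hg
    have h1 := left_ne_zero_of_mul hg
    have h2 := right_ne_zero_of_mul hg
    refine Set.mem_biUnion (x := k) ?_ ⟨n, ?_, rfl⟩
    · by_contra hk
      refine h1 ?_
      rw [Set.mem_Icc, not_and_or, not_le, not_le] at hk
      have := neg_abs_le (q x)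
      have := neg_abs_le (q y)
      have := le_abs_self (q x)
      have := le_abs_self (q y)
      have := abs_nonneg (q x)
      have := abs_nonneg (q y)
      rcases hk with hk | hk
      · rw [if_pos (by omega), if_pos (by omega)]
        decide
      · rw [if_neg (by omega), if_neg (by omega)]
        simp
    · rw [Function.mem_support, map_mul_map]
      simpa [mul_assoc] using h2

theorem orbitSum_extension (h : IsInfiniteCyclicExtension N M t) {f : List G → ZMod 2}
    (hf : IsLocallyFinite M f) (hfN : IsLocallyFinite N f) (c : ListChain G) :
    orbitSum M f c = ∑ᶠ k : ℤ, orbitSum N f (act (t ^ k) c) := by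
  rw [orbitSum_eq_finsum hf, ← finsum_comp_equiv h.coord, finsum_curry]
  · refine finsum_congr fun k => ?_
    rw [orbitSum_eq_finsum hfN]
    refine finsum_congr fun n => ?_
    rw [← act_mul]
    rfl
  · exact (hf.support_finite c).preimage h.coord.injective.injOn

theorem exists_height_bound {X : Type*} (q : X → ℤ) (z : ListChain X) :
    ∃ K : ℤ, 0 < K ∧ ∀ l ∈ z.support, ∀ x ∈ l, |q x| < K := by
  have hfin : {x | ∃ l ∈ z.support, x ∈ l}.Finite := by
    have : {x | ∃ l ∈ z.support, x ∈ l} = ⋃ l ∈ z.support, {x | x ∈ l} := by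
      ext; simp
    rw [this]
    exact Set.Finite.biUnion (Finset.finite_toSet _) fun l _ => List.finite_toSet l
  obtain ⟨K, hK⟩ := (hfin.image fun x => |q x|).bddAbove
  refine ⟨max K 0 + 1, by positivity, fun l hl x hx => ?_⟩
  have := hK ⟨x, ⟨l, hl, hx⟩, rfl⟩
  exact lt_of_le_of_lt (le_trans this (le_max_left _ _)) (lt_add_one _)

/-- Far up, all vertices of `t ^ k z` have nonnegative height and the jump function is 0 on them;
far down it is 1. -/
theorem exists_shift_bound {q : G → ℤ}
    (hqN : ∀ n ∈ N, ∀ x, q (n * x) = q x) (hqt : ∀ (k : ℤ) x, q (t ^ k * x) = q x + k)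
    {φ : List G → ZMod 2} (h0 : φ [] = 0) (z : ListChain G) :
    ∃ K : ℤ, (∀ k, K ≤ k →
      orbitSum N (headMul (fun x => if q x < 0 then 1 else 0) φ) (act (t ^ k) z) = 0) ∧
      ∀ k, k ≤ -K → orbitSum N (headMul (fun x => if q x < 0 then 1 else 0) φ) (act (t ^ k) z) =
        orbitSum N φ (act (t ^ k) z) := by
  obtain ⟨K, -, hK⟩ := exists_height_bound q z
  have hz := Finsupp.mem_supported_support (ZMod 2) z
  refine ⟨K, fun k hk => ?_, fun k hk => ?_⟩
  · refine map_mem_of_mem_supported (orbitSum N _ ∘ₗ act (t ^ k)) ⊥ (fun l hl => ?_) hz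
    rw [Submodule.mem_bot, LinearMap.comp_apply, act_single, orbitSum, pair_single]
    rw [finsum_eq_zero_of_forall_eq_zero]
    intro n
    cases l with
    | nil => rfl
    | cons x l =>
      have := abs_lt.1 (hK _ hl x (by simp))
      simp only [List.map_cons, headMul, hqN _ n.2, hqt]
      rw [if_neg (by omega), zero_mul]
  · rw [← sub_eq_zero]
    refine map_mem_of_mem_supported (orbitSum N _ ∘ₗ act (t ^ k) - orbitSum N _ ∘ₗ act (t ^ k)) ⊥
      (fun l hl => ?_) hz
    rw [Submodule.mem_bot, LinearMap.sub_apply, LinearMap.comp_apply, LinearMap.comp_apply,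
      act_single, orbitSum, orbitSum, pair_single, pair_single, sub_eq_zero]
    refine finsum_congr fun n => ?_
    cases l with
    | nil => exact h0.symm
    | cons x l =>
      have := abs_lt.1 (hK _ hl x (by simp))
      simp only [List.map_cons, headMul, hqN _ n.2, hqt]
      rw [if_pos (by omega), one_mul]

theorem HasTopClass.extension {m : ℕ} (hN : HasTopClass N m)
    (h : IsInfiniteCyclicExtension N M t) : HasTopClass M (m + 1) := by
  refine ⟨fun d hd w hw hwM => ?_, fun w hw w' hw' hwM hwM' hb hb' => ?_, ?_⟩
  · obtain ⟨d, rfl⟩ : ∃ e, d = e + 2 := ⟨d - 2, by omega⟩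
    obtain ⟨v, hv, hvN, hwv⟩ := exists_connecting h hw hwM
    obtain ⟨w', hw', hwN', hww'⟩ := exists_of_bounds_connecting h hw hwv
      (hN.vanishing _ (by omega) v hv hvN)
    exact (hN.vanishing _ (by omega) w' hw' hwN').of_add_mem_null h.le hww'
  · have key : ∀ w ∈ homog (Set.univ : Set G) (m + 2), ∀ v, bdry w + (act t v + v) ∈ null N →
        Bounds N (m + 1) v → Bounds M (m + 2) w := fun w hw v hwv hv => by
      obtain ⟨w', hw', hwN', hww'⟩ := exists_of_bounds_connecting h hw hwv hv
      exact (hN.vanishing _ (by omega) w' hw' hwN').of_add_mem_null h.le hww'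
    obtain ⟨v, hv, hvN, hwv⟩ := exists_connecting h hw hwM
    obtain ⟨v', hv', hvN', hwv'⟩ := exists_connecting h hw' hwM'
    refine key _ (add_mem hw hw') (v + v') ?_ (hN.unique v hv v' hv' hvN hvN'
      (fun hbv => hb (key w hw v hwv hbv)) fun hbv => hb' (key w' hw' v' hwv' hbv))
    convert add_mem hwv hwv' using 1
    rw [map_add, map_add]
    abel
  · obtain ⟨φ, hlen, hφ, hf, z, hz, hzN, hz1⟩ := hN.detected
    obtain ⟨q, -, hqN, hqt⟩ := h.exists_height
    have h0 : φ [] = 0 := hlen _ (by simp)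
    have hact := hN.detected_act h h0 hφ hf hz hzN hz1
    -- `z` and `t z` are homologous over `N`. The filling `b` closes up over `M`, where `z` and `t
    -- z` agree, like the mapping torus of the class of `z`.
    obtain ⟨b, hb, hbN⟩ := hN.unique z hz (act t z) (act_mem_homog t hz) hzN
      (by rw [bdry_act]; exact act_mem_null (fun n hn => (h.conj_mem_iff n).2 hn) hzN)
      (by simpa using (hact 0).1) (by simpa using (hact 1).1)
    -- `f` is not locally finite over `M` in general, so its coboundary can be a nontrivial cocycle
    -- there.
    let f := headMul (fun x => if q x < 0 then 1 else 0) φ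
    have hfN : IsLocallyFinite N f := hf.headMul _
    have hfM : IsLocallyFinite M (coboundary f) :=
      isLocallyFinite_coboundary_headMul h hqN hqt hφ hf
    refine ⟨coboundary f, fun l hl => ?_, fun l => ?_, hfM, b, hb, ?_, ?_⟩
    · cases l with
      | nil => simp [coboundary]
      | cons x l =>
        refine pair_eq_zero (s := {l' | l'.length = l.length ∧ _}) (fun l' hl' => ?_)
          (bdry_mem_homog (s := Set.univ) (single_mem_homog rfl (by simp) 1))
        exact headMul_eq_zero _ (hlen _ fun e => hl (by rw [List.length_cons, ← hl'.1, e]))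
    · rw [coboundary, pair_coboundary, bdry_bdry, map_zero]
    · convert add_mem (null_mono h.le hbN) (act_add_mem_null h.mem z) using 1
      rw [show z + act t z + bdry b + (act t z + z) = bdry b + (act t z + act t z) + (z + z) by abel,
        ZModModule.add_self, ZModModule.add_self, add_zero, add_zero]
    -- Summed first over `N`, the cocycle on `t ^ k b` is `T k + T (k + 1)`, where `T k` is the sum
    -- of `f` on `t ^ k z`. The sequence `T` jumps from 1 to 0, so the total is 1.
    · obtain ⟨K, hK0, hK1⟩ := exists_shift_bound hqN hqt h0 z
      rw [orbitSum_extension h hfM hfN.coboundary]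
      rw [← finsum_add_shift (T := fun k => orbitSum N f (act (t ^ k) z)) hK0
        fun k hk => (hK1 k hk).trans (hact k).2]
      refine finsum_congr fun k => ?_
      have hnull := orbitSum_eq_zero_of_mem_null (f := f) rfl
        (act_mem_null (h.zpow_conj_mem k) hbN)
      rw [orbitSum_coboundary hfN, bdry_act]
      rw [map_add, map_add, map_add, map_add, ← act_mul, ← zpow_add_one] at hnull
      rw [← ZModModule.neg_eq_self (orbitSum N f (act (t ^ k) (bdry b)))]
      exact (eq_neg_of_add_eq_zero_left hnull).symm

end ListChain

namespace ListChain

/-! ### Sorting chains -/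

section Sorting

variable {X Y : Type*} [LinearOrder Y]

/-- Insertion of a vertex in a sorted simplex; the result is zero if it is a vertex already. -/
noncomputable def insertList (x : Y) : List Y → ListChain Y
  | [] => Finsupp.single [x] 1
  | a :: l => if x < a then Finsupp.single (x :: a :: l) 1 else
      if x = a then 0 else cone a (insertList x l)

/-- The linear extension of `insertList`. -/
noncomputable def insert (x : Y) : ListChain Y →ₗ[ZMod 2] ListChain Y :=
  Finsupp.linearCombination _ (insertList x)

theorem insert_single (x : Y) (l : List Y) : insert x (Finsupp.single l 1) = insertList x l := by
  simp [insert]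

theorem insert_cone_of_lt {x a : Y} (h : x < a) (c : ListChain Y) :
    insert x (cone a c) = cone x (cone a c) := by
  have : insert x ∘ₗ cone a = cone x ∘ₗ cone a := hom_ext fun l => by
    simp [insert_single, insertList, h]
  exact LinearMap.congr_fun this c

theorem insert_cone_self (x : Y) (c : ListChain Y) : insert x (cone x c) = 0 := by
  have : insert x ∘ₗ cone x = 0 := hom_ext fun l => by
    simp [insert_single, insertList]
  exact LinearMap.congr_fun this c

theorem insert_cone_of_gt {x a : Y} (h : a < x) (c : ListChain Y) :
    insert x (cone a c) = cone a (insert x c) := by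
  have : insert x ∘ₗ cone a = cone a ∘ₗ insert x := hom_ext fun l => by
    simp [insert_single, insertList, h.not_gt, h.ne']
  exact LinearMap.congr_fun this c

theorem insertList_of_lt {x : Y} {l : List Y} (h : ∀ a ∈ l, x < a) :
    insertList x l = Finsupp.single (x :: l) 1 := by
  cases l with
  | nil => rfl
  | cons a l => rw [insertList, if_pos (h a (by simp))]

/-- Insertion obeys the boundary formula of a cone, which makes sorting a chain map; modulo 2 the
permutation has no sign. If `x` is already a vertex, the two terms on the right cancel. -/
theorem bdry_insertList (x : Y) {l : List Y} (hl : l.Pairwise (· < ·)) :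
    bdry (insertList x l) = Finsupp.single l 1 + insert x (bdry (Finsupp.single l 1)) := by
  induction l with
  | nil => simp [insertList, bdry_cons]
  | cons a l ih =>
    rw [List.pairwise_cons] at hl
    rcases lt_trichotomy x a with h | rfl | h
    · rw [insertList, if_pos h, bdry_cons, bdry_cons, map_add, map_add, insert_cone_of_lt h,
        insert_single, insertList_of_lt fun b hb => h.trans (hl.1 b hb), cone_single]
    · rw [insertList, if_neg (lt_irrefl x), if_pos rfl, bdry_cons, map_add, insert_cone_self,
        insert_single, insertList_of_lt hl.1, add_zero, map_zero, ZModModule.add_self]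
    · rw [insertList, if_neg h.not_gt, if_neg h.ne', bdry_cone, ih hl.2, bdry_cons, map_add, map_add,
        insert_cone_of_gt h, insert_single, cone_single]
      abel

theorem insertList_eq_zero {x : Y} {l : List Y} (hl : l.Pairwise (· < ·)) (hx : x ∈ l) :
    insertList x l = 0 := by
  induction l with
  | nil => simp at hx
  | cons a l ih =>
    rw [List.pairwise_cons] at hl
    rcases List.mem_cons.1 hx with rfl | hx
    · simp [insertList]
    · rw [insertList, if_neg (hl.1 x hx).not_gt, if_neg (hl.1 x hx).ne', ih hl.2 hx, map_zero]

/-- The chains spanned by the increasing enumerations of the list `s`. -/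
noncomputable def sorted (s : List Y) : Submodule (ZMod 2) (ListChain Y) :=
  Finsupp.supported _ _ {l | l.Pairwise (· < ·) ∧ (∀ y, y ∈ l ↔ y ∈ s) ∧ l.length = s.length}

theorem insertList_mem_sorted (x : Y) {l : List Y} (hl : l.Pairwise (· < ·)) :
    insertList x l ∈ sorted (x :: l) := by
  induction l with
  | nil => exact Finsupp.single_mem_supported _ _ (by simp)
  | cons a l ih =>
    rw [insertList]
    split_ifs with h h'
    · refine Finsupp.single_mem_supported _ _ ⟨List.pairwise_cons.2 ⟨?_, hl⟩, by simp, rfl⟩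
      rw [List.pairwise_cons] at hl
      exact List.forall_mem_cons.2 ⟨h, fun b hb => h.trans (hl.1 b hb)⟩
    · exact zero_mem _
    · rw [List.pairwise_cons] at hl
      have hax : a < x := lt_of_le_of_ne (not_lt.1 h) (Ne.symm h')
      refine map_mem_of_mem_supported (cone a) _ (fun l' hl' => ?_) (ih hl.2)
      rw [cone_single]
      refine Finsupp.single_mem_supported _ _ ⟨List.pairwise_cons.2 ⟨fun b hb => ?_, hl'.1⟩, ?_, ?_⟩
      · rcases List.mem_cons.1 ((hl'.2.1 b).1 hb) with rfl | hb
        · exact hax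
        · exact hl.1 b hb
      · intro y
        rw [List.mem_cons, hl'.2.1, List.mem_cons, List.mem_cons, List.mem_cons]
        tauto
      · simp [hl'.2.2]

/-- The image of a simplex under a vertex map, with its vertices sorted. -/
noncomputable def sortMapList (h : X → Y) : List X → ListChain Y
  | [] => Finsupp.single [] 1
  | x :: l => insert (h x) (sortMapList h l)

/-- The linear extension of `sortMapList`. -/
noncomputable def sortMap (h : X → Y) : ListChain X →ₗ[ZMod 2] ListChain Y :=
  Finsupp.linearCombination _ (sortMapList h)

theorem sortMap_single (h : X → Y) (l : List X) :
    sortMap h (Finsupp.single l 1) = sortMapList h l := by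
  simp [sortMap]

theorem sortMapList_mem_sorted (h : X → Y) (l : List X) :
    sortMapList h l ∈ sorted (l.map h) := by
  induction l with
  | nil => exact Finsupp.single_mem_supported _ _ (by simp)
  | cons x l ih =>
    refine map_mem_of_mem_supported (insert (h x)) _ (fun l' hl' => ?_) ih
    rw [insert_single]
    refine Finsupp.supported_mono ?_ (insertList_mem_sorted (h x) hl'.1)
    refine fun l'' h'' => ⟨h''.1, fun y => ?_, ?_⟩
    · rw [h''.2.1, List.mem_cons, hl'.2.1, List.map_cons, List.mem_cons]
    · simp [h''.2.2, hl'.2.2]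

theorem sortMapList_eq_zero (h : X → Y) {l : List X} (hl : ¬ (l.map h).Nodup) :
    sortMapList h l = 0 := by
  induction l with
  | nil => simp at hl
  | cons x l ih =>
    rw [sortMapList]
    by_cases hn : (l.map h).Nodup
    · have hx : h x ∈ l.map h := by
        by_contra hx
        exact hl (List.nodup_cons.2 ⟨hx, hn⟩)
      refine map_mem_of_mem_supported (insert (h x)) ⊥ (fun l' hl' => ?_)
        (sortMapList_mem_sorted h l)
      rw [insert_single, insertList_eq_zero hl'.1 ((hl'.2.1 _).2 hx)]
      exact zero_mem _
    · rw [ih hn, map_zero]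

theorem bdry_sortMap (h : X → Y) (c : ListChain X) :
    bdry (sortMap h c) = sortMap h (bdry c) := by
  have hcone : ∀ x c, sortMap h (cone x c) = insert (h x) (sortMap h c) := fun x c => by
    have : sortMap h ∘ₗ cone x = insert (h x) ∘ₗ sortMap h := hom_ext fun l => by
      simp [sortMap_single, sortMapList]
    exact LinearMap.congr_fun this c
  have hins : ∀ x (l : List X), bdry (insert x (sortMapList h l)) =
      sortMapList h l + insert x (bdry (sortMapList h l)) := fun x l => by
    have := map_mem_of_mem_supported
      (bdry ∘ₗ insert x - (LinearMap.id + insert x ∘ₗ bdry)) ⊥ (fun l' hl' => ?_)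
      (sortMapList_mem_sorted h l)
    · exact sub_eq_zero.1 this
    · rw [Submodule.mem_bot, LinearMap.sub_apply, sub_eq_zero]
      simp only [LinearMap.comp_apply, LinearMap.add_apply, LinearMap.id_apply, insert_single]
      exact bdry_insertList x hl'.1
  have : bdry ∘ₗ sortMap h = sortMap h ∘ₗ bdry := hom_ext fun l => by
    rw [LinearMap.comp_apply, LinearMap.comp_apply]
    induction l with
    | nil => simp [sortMap_single, sortMapList]
    | cons x l ih =>
      rw [sortMap_single] at ih ⊢
      rw [sortMapList, hins, ih, bdry_cons, map_add, hcone, sortMap_single]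
  exact LinearMap.congr_fun this c

end Sorting

/-! ### Homotopies -/

section Homotopy

variable {X : Type*}

/-- The conical homotopy on simplices with at most `d` vertices. -/
noncomputable def homotopyAux (F : ListChain X →ₗ[ZMod 2] ListChain X) :
    ℕ → List X → ListChain X
  | 0, _ => 0
  | _ + 1, [] => 0
  | d + 1, x :: l => cone x (Finsupp.single (x :: l) 1 + F (Finsupp.single (x :: l) 1) +
      Finsupp.linearCombination (ZMod 2) (homotopyAux F d) (bdry (Finsupp.single (x :: l) 1)))

/-- The conical homotopy from the identity to an augmented chain map. -/
noncomputable def homotopy (F : ListChain X →ₗ[ZMod 2] ListChain X) :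
    ListChain X →ₗ[ZMod 2] ListChain X :=
  Finsupp.linearCombination _ fun l => homotopyAux F l.length l

variable {F : ListChain X →ₗ[ZMod 2] ListChain X}

theorem homotopy_nil : homotopy F (Finsupp.single [] 1) = 0 := by
  simp [homotopy, homotopyAux]

/-- The recursion depth of `homotopyAux` is the number of vertices. All faces have one vertex fewer,
so the depths match and the recursive formula holds for `homotopy` itself. -/
theorem homotopy_cons (x : X) (l : List X) :
    homotopy F (Finsupp.single (x :: l) 1) =
      cone x (Finsupp.single (x :: l) 1 + F (Finsupp.single (x :: l) 1) +
        homotopy F (bdry (Finsupp.single (x :: l) 1))) := by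
  have : ∀ c ∈ homog (Set.univ : Set X) l.length,
      homotopy F c = Finsupp.linearCombination (ZMod 2) (homotopyAux F l.length) c := fun c hc => by
    refine sub_eq_zero.1 (map_mem_of_mem_supported
      (homotopy F - Finsupp.linearCombination (ZMod 2) (homotopyAux F l.length)) ⊥
      (fun l' hl' => ?_) hc)
    simp [homotopy, hl'.1]
  rw [this _ (bdry_mem_homog (single_mem_homog rfl (by simp) 1))]
  simp [homotopy, homotopyAux]

/-- By induction the chain coned off in the definition is a cycle, and a cone over a cycle has that
cycle as its boundary. -/
theorem bdry_homotopy (hF : ∀ c, bdry (F c) = F (bdry c))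
    (hF0 : F (Finsupp.single [] 1) = Finsupp.single [] 1) {d : ℕ} {c : ListChain X}
    (hc : c ∈ homog Set.univ d) : bdry (homotopy F c) + homotopy F (bdry c) = c + F c := by
  induction d generalizing c with
  | zero =>
    rw [homog_zero hc, ← mul_one (c []), ← smul_eq_mul, ← Finsupp.smul_single]
    simp only [map_smul, homotopy_nil, bdry_nil, hF0, map_zero, smul_zero, add_zero]
    exact (ZModModule.add_self _).symm
  | succ d ih =>
    refine sub_eq_zero.1 (map_mem_of_mem_supported
      (bdry ∘ₗ homotopy F + homotopy F ∘ₗ bdry - (LinearMap.id + F)) ⊥ (fun l hl => ?_) hc)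
    obtain ⟨x, l, rfl⟩ := List.exists_cons_of_length_pos (l := l) (by rw [hl.1]; omega)
    rw [Submodule.mem_bot, LinearMap.sub_apply, sub_eq_zero]
    simp only [LinearMap.comp_apply, LinearMap.add_apply, LinearMap.id_apply]
    have h := ih (bdry_mem_homog (single_mem_homog hl.1 (by simp) 1))
    rw [bdry_bdry, map_zero, add_zero] at h
    rw [homotopy_cons, bdry_cone, map_add bdry, map_add bdry, hF, h, ZModModule.add_self, map_zero, add_zero,
      add_assoc, ZModModule.add_self, add_zero]

theorem homotopy_mem_homog {h : X → X}
    (hF : ∀ l : List X, F (Finsupp.single l 1) ∈ homog {y | ∃ x ∈ l, y = x ∨ y = h x} l.length)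
    (l : List X) :
    homotopy F (Finsupp.single l 1) ∈ homog {y | ∃ x ∈ l, y = x ∨ y = h x} (l.length + 1) := by
  generalize hd : l.length = d
  induction d generalizing l with
  | zero => rw [List.length_eq_zero_iff.1 hd, homotopy_nil]; exact zero_mem _
  | succ d ih =>
    obtain ⟨x, l, rfl⟩ := List.exists_cons_of_length_pos (l := l) (by omega)
    rw [homotopy_cons]
    have hs : ∀ y ∈ x :: l, y ∈ {y | ∃ z ∈ x :: l, y = z ∨ y = h z} := fun y hy =>
      ⟨y, hy, Or.inl rfl⟩
    refine cone_mem_homog (hs x List.mem_cons_self) (add_mem (add_mem ?_ ?_) ?_)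
    · exact single_mem_homog hd hs _
    · exact hd ▸ hF _
    · refine map_mem_of_mem_supported (homotopy F) _ (fun l' hl' => ?_)
        (bdry_mem_homog (s := {y | y ∈ x :: l}) (single_mem_homog hd (by simp) 1))
      refine homog_mono ?_ _ (ih l' hl'.1)
      rintro y ⟨x', hx', hy⟩
      exact ⟨x', hl'.2 x' hx', hy⟩

end Homotopy

end ListChain

/-- The subgroup `H` of `G` has asymptotic dimension at most `n`, in terms of maps of bounded
displacement that take few values on the translates of a finite set. -/
def LabelDimLE {G : Type*} [Group G] (H : Subgroup G) (n : ℕ) : Prop :=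
  ∀ K : Set G, K.Finite → K ⊆ H → ∃ (h : G → G) (D : Set G), D.Finite ∧ (∀ x ∈ H, x⁻¹ * h x ∈ D) ∧
    ∀ x ∈ H, ((fun k => h (x * k)) '' K).encard ≤ n + 1

/-! ### The lower bound: a top class obstructs labellings with few values -/

namespace ListChain

variable {G : Type*} [Group G] {N : Subgroup G}

theorem finite_lists {X : Type*} {B : Set X} (hB : B.Finite) (d : ℕ) :
    {l : List X | l.length = d ∧ ∀ x ∈ l, x ∈ B}.Finite := by
  induction d with
  | zero => exact (Set.finite_singleton []).subset fun l hl => List.length_eq_zero_iff.1 hl.1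
  | succ d ih =>
    refine (Set.Finite.image2 List.cons hB ih).subset ?_
    rintro (_ | ⟨x, l⟩) ⟨hl, hx⟩
    · simp at hl
    · simp only [List.mem_cons, forall_eq_or_imp] at hx
      exact ⟨x, hx.1, l, ⟨by simpa using hl, hx.2⟩, rfl⟩

/-- The homotopy of a translate `g l` uses only vertices in `g B`, with `B` finite and independent
of `g`. So finitely many simplices, translated by `g`, have to be tested against `φ`. -/
theorem IsLocallyFinite.comp_homotopy {φ : List G → ZMod 2} (hf : IsLocallyFinite N φ)
    {F : ListChain G →ₗ[ZMod 2] ListChain G} {h : G → G} {D : Set G} (hD : D.Finite)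
    (hh : ∀ x, x⁻¹ * h x ∈ D)
    (hF : ∀ l : List G, F (Finsupp.single l 1) ∈ homog {y | ∃ x ∈ l, y = x ∨ y = h x} l.length) :
    IsLocallyFinite N fun l => pair φ (homotopy F (Finsupp.single l 1)) := fun l => by
  let B : Set G := Set.image2 (· * ·) {x | x ∈ l} (Set.insert 1 D)
  have hB : B.Finite := (List.finite_toSet l).image2 _ (hD.insert 1)
  refine ((finite_lists hB (l.length + 1)).biUnion fun l' _ => hf l').subset fun g hg => ?_
  by_contra hg'
  refine hg (pair_eq_zero (fun l' hl' => ?_) (homotopy_mem_homog hF (l.map ((g : G) * ·))))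
  by_contra hl0
  refine hg' (Set.mem_biUnion (x := l'.map ((g : G)⁻¹ * ·)) ⟨by simpa using hl'.1, ?_⟩ ?_)
  · intro y hy
    obtain ⟨y, hy', rfl⟩ := List.mem_map.1 hy
    obtain ⟨x, hx, hxy⟩ := hl'.2 y hy'
    obtain ⟨x, hx', rfl⟩ := List.mem_map.1 hx
    refine ⟨x, hx', x⁻¹ * ((g : G)⁻¹ * y), ?_, by simp⟩
    rcases hxy with rfl | rfl
    · exact Or.inl (by group)
    · refine Or.inr ?_
      simpa [mul_assoc] using hh (g * x)
  · rw [Function.mem_support, map_mul_map]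
    simpa using hl0

theorem HasTopClass.le_of_labelDimLE {m n : ℕ} (hN : HasTopClass N m)
    (hG : LabelDimLE (⊤ : Subgroup G) n) : m ≤ n := by
  by_contra! hnm
  obtain ⟨φ, hlen, hφ, hf, z, hz, hzN, hz1⟩ := hN.detected
  let V : Set G := ⋃ l ∈ z.support, {x | x ∈ l}
  have hV : V.Finite := Set.Finite.biUnion (Finset.finite_toSet _) fun l _ => List.finite_toSet l
  -- The finite set consists of the differences of vertices of `z`, so each translated simplex lies
  -- in the translate of this set by its first vertex.
  obtain ⟨h, D, hD, hhD, hcard⟩ := hG (Set.image2 (fun x y => x⁻¹ * y) V V) (hV.image2 _ hV)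
    (by simp)
  -- Any linear order serves; it need not be related to the group.
  let _ : LinearOrder G := IsWellOrder.linearOrder WellOrderingRel
  have hF : ∀ l : List G, sortMap h (Finsupp.single l 1) ∈
      homog {y | ∃ x ∈ l, y = x ∨ y = h x} l.length := fun l => by
    rw [sortMap_single]
    refine Finsupp.supported_mono ?_ (sortMapList_mem_sorted h l)
    refine fun l' hl' => ⟨by simpa using hl'.2.2, fun y hy => ?_⟩
    obtain ⟨x, hx, rfl⟩ := List.mem_map.1 ((hl'.2.1 y).1 hy)
    exact ⟨x, hx, Or.inr rfl⟩
  let ψ : List G → ZMod 2 := fun l => pair φ (homotopy (sortMap h) (Finsupp.single l 1))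
  have hψ : IsLocallyFinite N ψ := hf.comp_homotopy hD (fun x => hhD x trivial) hF
  have hψpair : ∀ c, pair ψ c = pair φ (homotopy (sortMap h) c) := fun c => by
    have : pair ψ = pair φ ∘ₗ homotopy (sortMap h) := hom_ext fun l => by simp [ψ]
    exact LinearMap.congr_fun this c
  have hdeg : ∀ g : G, ∀ l ∈ z.support, sortMapList h (l.map (g * ·)) = 0 := fun g l hl => by
    refine sortMapList_eq_zero h fun hnd => ?_
    obtain ⟨x, l', rfl⟩ := List.exists_cons_of_length_pos (l := l) (by rw [(hz hl).1]; omega)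
    have hle : ((((x :: l').map (g * ·)).map h).toFinset : Set G).encard ≤ n + 1 := by
      refine le_trans (Set.encard_le_encard fun y hy => ?_) (hcard (g * x) trivial)
      rw [Finset.mem_coe, List.mem_toFinset, List.map_map] at hy
      obtain ⟨y, hy', rfl⟩ := List.mem_map.1 hy
      refine ⟨x⁻¹ * y, ⟨x, Set.mem_biUnion hl List.mem_cons_self, y, Set.mem_biUnion hl hy', rfl⟩, ?_⟩
      simp [mul_assoc]
    rw [Set.encard_coe_eq_coe_finsetCard, List.toFinset_card_of_nodup hnd, List.length_map,
      List.length_map, (hz hl).1] at hle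
    have : m + 1 ≤ n + 1 := by exact_mod_cast hle
    omega
  -- In the homotopy formula the sorted image is zero and `φ` vanishes on the boundary term, so `φ`
  -- agrees with the coboundary of `ψ` on the translates of `z`.
  have hpair : ∀ g : N, pair φ (act (g : G) z) = pair (coboundary ψ) (act (g : G) z) := fun g => by
    refine sub_eq_zero.1 (map_mem_of_mem_supported
      (pair φ ∘ₗ act (g : G) - pair (coboundary ψ) ∘ₗ act (g : G)) ⊥ (fun l hl => ?_)
      (Finsupp.mem_supported_support (ZMod 2) z))
    rw [Submodule.mem_bot, LinearMap.sub_apply, sub_eq_zero, LinearMap.comp_apply,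
      LinearMap.comp_apply, act_single, pair_coboundary, hψpair]
    have e := bdry_homotopy (F := sortMap h) (bdry_sortMap h) (by simp [sortMap_single, sortMapList])
      (single_mem_homog (l := l.map ((g : G) * ·)) rfl (by simp) 1)
    rw [sortMap_single, hdeg g l hl, add_zero] at e
    nth_rewrite 1 [← e]
    rw [map_add, ← pair_coboundary, show coboundary φ = fun _ => 0 from funext hφ]
    simp [pair, Finsupp.linearCombination_apply]
  have hsum : orbitSum N φ z = orbitSum N ψ (bdry z) := by
    rw [← orbitSum_coboundary hψ, orbitSum_eq_finsum hf, orbitSum_eq_finsum hψ.coboundary]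
    exact finsum_congr hpair
  rw [hz1, orbitSum_eq_zero_of_mem_null (by simp [ψ, homotopy_nil]) hzN] at hsum
  exact one_ne_zero hsum

end ListChain

/-! ### Finite index subgroups of finitely generated groups -/

section FiniteIndex

variable {G : Type*} [Group G]

theorem finite_monoidHom_of_fg [Group.FG G] (P : Type*) [Group P] [Finite P] :
    Finite (G →* P) := by
  obtain ⟨S, hS, hfin⟩ := Group.fg_iff.1 (inferInstance : Group.FG G)
  have := hfin.to_subtype
  refine Finite.of_injective (fun (f : G →* P) (s : S) => f s) fun f g hfg => ?_
  exact MonoidHom.eq_of_eqOn_dense hS fun s hs => congrFun hfg ⟨s, hs⟩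

/-- A subgroup of index d is a point stabilizer of an action on d points, and a finitely generated
group has finitely many of these actions. -/
theorem finite_subgroups_of_index [Group.FG G] {d : ℕ} (hd : d ≠ 0) :
    {U : Subgroup G | U.index = d}.Finite := by
  have := finite_monoidHom_of_fg (G := G) (Equiv.Perm (Fin d))
  refine (Set.finite_range fun p : (G →* Equiv.Perm (Fin d)) × Fin d =>
    (MulAction.stabilizer (Equiv.Perm (Fin d)) p.2).comap p.1).subset fun U hU => ?_
  have hU' : Nat.card (G ⧸ U) = d := hU
  have : Finite (G ⧸ U) := Nat.finite_of_card_ne_zero (hU'.symm ▸ hd)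
  let e : G ⧸ U ≃ Fin d := Finite.equivFinOfCardEq hU'
  refine ⟨(e.permCongrHom.toMonoidHom.comp (MulAction.toPermHom G (G ⧸ U)), e (1 : G)), ?_⟩
  ext g
  have : (g : G ⧸ U) = ((1 : G) : G ⧸ U) ↔ g ∈ U := by
    rw [eq_comm, QuotientGroup.eq]
    simp
  rw [← this]
  simp [MulAction.mem_stabilizer_iff, Equiv.Perm.smul_def, Equiv.permCongrHom]

/-- A power of an element that normalizes a finitely generated group normalizes a given subgroup of
finite index. -/
theorem exists_pow_conj_mem_iff {N H : Subgroup G} {t : G} (hH : H.FG) (hNH : N ≤ H)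
    (hN : N.relIndex H ≠ 0) (ht : ∀ n, t * n * t⁻¹ ∈ H ↔ n ∈ H) :
    ∃ r : ℕ, 0 < r ∧ ∀ n, t ^ r * n * (t ^ r)⁻¹ ∈ N ↔ n ∈ N := by
  have : Group.FG H := (Group.fg_iff_subgroup_fg H).2 hH
  let C : ℕ → Subgroup G := fun k => N.map (MulAut.conj (t ^ k)).toMonoidHom
  have hmem : ∀ k n, t ^ k * n * (t ^ k)⁻¹ ∈ C k ↔ n ∈ N := fun k n => by
    simp only [C, Subgroup.mem_map, MulEquiv.coe_toMonoidHom, MulAut.conj_apply]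
    constructor
    · rintro ⟨x, hx, e⟩
      rwa [← mul_left_cancel (mul_right_cancel e)]
    · exact fun h => ⟨n, h, rfl⟩
  have hHk : ∀ k : ℕ, H.map (MulAut.conj (t ^ k)).toMonoidHom = H := fun k => by
    ext x
    simp only [Subgroup.mem_map, MulEquiv.coe_toMonoidHom, MulAut.conj_apply]
    constructor
    · rintro ⟨y, hy, rfl⟩
      exact_mod_cast Subgroup.zpow_conj_mem ht k y hy
    · intro hx
      refine ⟨_, Subgroup.zpow_conj_mem ht (-k) x hx, ?_⟩
      simp [mul_assoc]
  have hC : ∀ k, C k ≤ H := fun k => (Subgroup.map_mono hNH).trans (hHk k).le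
  have hidx : ∀ k, ((C k).subgroupOf H).index = N.relIndex H := fun k => by
    have := Subgroup.relIndex_map_map_of_injective N H
      (f := (MulAut.conj (t ^ k)).toMonoidHom) (MulAut.conj (t ^ k)).injective
    rw [hHk] at this
    exact this
  -- The conjugates of `N` by powers of `t` all have the same index in `H`, so two of them coincide.
  obtain ⟨k, -, k', -, hne, e⟩ := Set.infinite_univ.exists_ne_map_eq_of_mapsTo
    (f := fun k => (C k).subgroupOf H) (fun k _ => hidx k)
    (finite_subgroups_of_index hN)
  wlog hlt : k < k' generalizing k k'
  · exact this k' k hne.symm e.symm (by omega)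
  have e' : C k = C k' := by
    rw [← inf_eq_left.2 (hC k), ← inf_eq_left.2 (hC k')]
    exact Subgroup.subgroupOf_inj.1 e
  refine ⟨k' - k, by omega, fun n => ?_⟩
  rw [← hmem k, e', ← hmem k' n, ← Nat.add_sub_cancel' hlt.le, pow_add]
  simp [mul_assoc]

/-- The subgroup of the products of elements of `N` and powers of an element that normalizes `N`. -/
def cyclicExtension (N : Subgroup G) (t : G) (ht : ∀ n, t * n * t⁻¹ ∈ N ↔ n ∈ N) : Subgroup G where
  carrier := {g | ∃ n ∈ N, ∃ k : ℤ, g = n * t ^ k}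
  one_mem' := ⟨1, one_mem N, 0, by simp⟩
  mul_mem' := by
    rintro _ _ ⟨n, hn, k, rfl⟩ ⟨n', hn', k', rfl⟩
    refine ⟨_, mul_mem hn (Subgroup.zpow_conj_mem ht k n' hn'), k + k', ?_⟩
    rw [zpow_add]
    group
  inv_mem' := by
    rintro _ ⟨n, hn, k, rfl⟩
    refine ⟨_, Subgroup.zpow_conj_mem ht (-k) _ (inv_mem hn), -k, ?_⟩
    group

theorem isCyclicExtension_cyclicExtension {N : Subgroup G} {t : G}
    (ht : ∀ n, t * n * t⁻¹ ∈ N ↔ n ∈ N) : IsCyclicExtension N (cyclicExtension N t ht) t :=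
  ⟨ht, fun _ => Iff.rfl⟩

/-- The products of `t ^ b`, for `b < r`, with representatives of `H` modulo `N` meet every coset.
-/
theorem relIndex_cyclicExtension_ne_zero {N H M : Subgroup G} {t : G}
    (h : IsCyclicExtension H M t) (hN : N.relIndex H ≠ 0) {r : ℕ} (hr : 0 < r)
    (ht : ∀ n, t ^ r * n * (t ^ r)⁻¹ ∈ N ↔ n ∈ N) :
    (cyclicExtension N (t ^ r) ht).relIndex M ≠ 0 := by
  have : Finite (H ⧸ N.subgroupOf H) := Subgroup.index_ne_zero_iff_finite.1 hN
  let E := cyclicExtension N (t ^ r) ht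
  let f : Fin r × (H ⧸ N.subgroupOf H) → M ⧸ E.subgroupOf M := fun p =>
    ((⟨t ^ (p.1 : ℕ) * p.2.out, mul_mem (pow_mem h.mem _) (h.le p.2.out.2)⟩ : M) : M ⧸ _)
  have hf : Function.Surjective f := by
    rintro ⟨⟨x, hx⟩⟩
    obtain ⟨n, hn, k, rfl⟩ := (h.mem_iff x).1 hx
    have hr' : (r : ℤ) ≠ 0 := by exact_mod_cast hr.ne'
    obtain ⟨b, hb⟩ := Int.eq_ofNat_of_zero_le (Int.emod_nonneg k hr')
    have hbr : b < r := by
      have := Int.emod_lt_of_pos k (show (0 : ℤ) < r by exact_mod_cast hr)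
      omega
    have hk : k = b + r * (k / r) := by rw [← hb, add_comm]; exact (Int.mul_ediv_add_emod k r).symm
    have hm := h.zpow_conj_mem (-b) n hn
    let m : H := ⟨_, hm⟩
    let c : H ⧸ N.subgroupOf H := (m : H ⧸ _)
    have hc : ((c.out)⁻¹ * m : G) ∈ N := by
      have : (c.out : H ⧸ N.subgroupOf H) = (m : H ⧸ _) := Quotient.out_eq _
      have := QuotientGroup.eq.1 this
      exact this
    refine ⟨(⟨b, hbr⟩, c), QuotientGroup.eq.2 ?_⟩
    refine ⟨_, hc, k / r, ?_⟩
    simp only [Subgroup.coe_mul, Subgroup.subtype_apply, InvMemClass.coe_inv, m]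
    nth_rewrite 1 [hk]
    rw [zpow_add, ← zpow_natCast t r, ← zpow_mul, ← zpow_natCast t b]
    group
  have : Finite (M ⧸ E.subgroupOf M) := Finite.of_surjective f hf
  exact Subgroup.index_ne_zero_iff_finite.2 this

end FiniteIndex

/-! ### Polycyclic series -/

theorem IsCyclicExtension.eq_sup {G : Type*} [Group G] {N M : Subgroup G} {t : G}
    (h : IsCyclicExtension N M t) : M = N ⊔ Subgroup.zpowers t := by
  refine le_antisymm (fun x hx => ?_) (sup_le h.le (by simpa using h.mem))
  obtain ⟨n, hn, k, rfl⟩ := (h.mem_iff x).1 hx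
  exact mul_mem (Subgroup.mem_sup_left hn) (Subgroup.mem_sup_right ⟨k, rfl⟩)

theorem IsCyclicExtension.relIndex_ne_zero {G : Type*} [Group G] {N M : Subgroup G} {t : G}
    (h : IsCyclicExtension N M t) {r : ℕ} (hr : 0 < r) (ht : t ^ r ∈ N) : N.relIndex M ≠ 0 := by
  have hconj : ∀ n, t ^ r * n * (t ^ r)⁻¹ ∈ N ↔ n ∈ N := fun n => by
    rw [Subgroup.mul_mem_cancel_right _ (inv_mem ht), Subgroup.mul_mem_cancel_left _ ht]
  have := relIndex_cyclicExtension_ne_zero h (N := N) (by simp) hr hconj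
  have e : cyclicExtension N (t ^ r) hconj = N := by
    refine le_antisymm ?_ fun n hn => ⟨n, hn, 0, by simp⟩
    rintro _ ⟨n, hn, k, rfl⟩
    exact mul_mem hn (zpow_mem ht k)
  rwa [e] at this

theorem exists_isCyclicExtension {G : Type*} [Group G] {N M : Subgroup G} (hNM : N ≤ M)
    (hn : (N.subgroupOf M).Normal) (hc : IsCyclic (M ⧸ N.subgroupOf M)) :
    ∃ t, IsCyclicExtension N M t ∧
      (Nonempty ((M ⧸ N.subgroupOf M) ≃* Multiplicative ℤ) ↔ ∀ k : ℤ, t ^ k ∈ N → k = 0) := by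
  obtain ⟨g, hg⟩ := hc.exists_generator
  obtain ⟨⟨t, ht⟩, rfl⟩ := QuotientGroup.mk_surjective g
  have hpow : ∀ k : ℤ, ((⟨t, ht⟩ : M) : M ⧸ N.subgroupOf M) ^ k = 1 ↔ t ^ k ∈ N := fun k => by
    rw [← QuotientGroup.mk_zpow, QuotientGroup.eq_one_iff, Subgroup.mem_subgroupOf]
    rfl
  have hconj : ∀ s ∈ M, ∀ n ∈ N, s * n * s⁻¹ ∈ N := fun s hs n hn' =>
    hn.conj_mem ⟨n, hNM hn'⟩ hn' ⟨s, hs⟩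
  refine ⟨t, ⟨fun n => ⟨fun h => ?_, hconj t ht n⟩, fun x => ⟨fun hx => ?_, ?_⟩⟩, ?_, ?_⟩
  · simpa [mul_assoc] using hconj t⁻¹ (inv_mem ht) _ h
  · obtain ⟨k, hk⟩ := hg ((⟨x, hx⟩ : M) : M ⧸ N.subgroupOf M)
    simp only [← QuotientGroup.mk_zpow] at hk
    have h1 := QuotientGroup.eq.1 hk
    replace h1 : (t ^ k)⁻¹ * x ∈ N := h1
    refine ⟨x * (t ^ k)⁻¹, ?_, k, by simp⟩
    simpa [mul_assoc] using hconj _ (zpow_mem ht k) _ h1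
  · rintro ⟨n, hn', k, rfl⟩
    exact mul_mem (hNM hn') (zpow_mem ht k)
  -- If a nonzero power of `t` lay in `N`, the generator would go to a torsion element of ℤ, that is
  -- to 0, and could not generate.
  · rintro ⟨e⟩ k hk
    by_contra hk0
    have h1 := congrArg e ((hpow k).2 hk)
    rw [map_zpow, map_one] at h1
    have h2 : Multiplicative.toAdd (e ((⟨t, ht⟩ : M) : M ⧸ N.subgroupOf M)) = 0 := by
      have := congrArg Multiplicative.toAdd h1
      rw [toAdd_zpow, toAdd_one, smul_eq_mul] at this
      exact (mul_eq_zero.1 this).resolve_left hk0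
    obtain ⟨j, hj⟩ := hg (e.symm (Multiplicative.ofAdd 1))
    have h3 := congrArg (fun x => Multiplicative.toAdd (e x)) hj
    simp [h2] at h3
  · intro h
    refine ⟨(MulEquiv.ofBijective (zpowersHom _ ((⟨t, ht⟩ : M) : M ⧸ N.subgroupOf M))
      ⟨(injective_iff_map_eq_one _).2 fun k hk => ?_, fun x => ?_⟩).symm⟩
    · exact h _ ((hpow _).1 hk)
    · obtain ⟨k, hk⟩ := hg x
      exact ⟨Multiplicative.ofAdd k, hk⟩

/-- Induction along a polycyclic series, with the count of the infinite factors. -/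
theorem PolycyclicSeries.induction {G : Type*} [Group G] (σ : PolycyclicSeries G)
    {P : Subgroup G → ℕ → Prop} (bot : P ⊥ 0)
    (infinite : ∀ N M t m, IsInfiniteCyclicExtension N M t → P N m → P M (m + 1))
    (finite : ∀ N M t (r : ℕ) m, IsCyclicExtension N M t → 0 < r → t ^ r ∈ N → P N m → P M m) :
    P ⊤ σ.hirsch := by
  let I : Fin σ.length → Prop := fun i =>
    haveI := σ.normal i
    Nonempty ((σ.subgroup i.succ ⧸ (σ.subgroup i.castSucc).subgroupOf (σ.subgroup i.succ)) ≃*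
      Multiplicative ℤ)
  have key : ∀ i : Fin (σ.length + 1), P (σ.subgroup i) {j | j.castSucc < i ∧ I j}.ncard := by
    intro i
    induction i using Fin.induction with
    | zero =>
      rw [σ.bot]
      simpa using bot
    | succ i ih =>
      have hn := σ.normal i
      obtain ⟨t, ht, hI⟩ := exists_isCyclicExtension (σ.le i) hn (σ.cyclic i)
      by_cases hi : I i
      · have e : {j | j.castSucc < i.succ ∧ I j} =
            Insert.insert i {j | j.castSucc < i.castSucc ∧ I j} := by
          ext j
          simp only [Set.mem_ofPred_eq, Set.mem_insert_iff, Fin.castSucc_lt_succ_iff,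
            Fin.castSucc_lt_castSucc_iff, le_iff_eq_or_lt]
          constructor
          · rintro ⟨h | h, h'⟩
            · exact Or.inl h
            · exact Or.inr ⟨h, h'⟩
          · rintro (rfl | ⟨h, h'⟩)
            · exact ⟨Or.inl rfl, hi⟩
            · exact ⟨Or.inr h, h'⟩
        rw [e, Set.ncard_insert_of_notMem (by simp) (Set.toFinite _)]
        exact infinite _ _ t _ ⟨ht, hI.1 hi⟩ ih
      · have e : {j | j.castSucc < i.succ ∧ I j} = {j | j.castSucc < i.castSucc ∧ I j} := by
          ext j
          simp only [Set.mem_ofPred_eq, Fin.castSucc_lt_succ_iff,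
            Fin.castSucc_lt_castSucc_iff, le_iff_eq_or_lt]
          constructor
          · rintro ⟨rfl | h, h'⟩
            · exact absurd h' hi
            · exact ⟨h, h'⟩
          · exact fun h => ⟨Or.inr h.1, h.2⟩
        rw [e]
        have : ∃ k : ℤ, t ^ k ∈ σ.subgroup i.castSucc ∧ k ≠ 0 := by
          by_contra! h
          exact hi (hI.2 h)
        obtain ⟨k, hk, hk0⟩ := this
        refine finite _ _ t k.natAbs _ ht (Int.natAbs_pos.2 hk0) ?_ ih
        rcases Int.natAbs_eq k with h | h
        · rw [h, zpow_natCast] at hk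
          exact hk
        · rw [h, zpow_neg, zpow_natCast] at hk
          exact inv_mem_iff.1 hk
  have := key (Fin.last _)
  rw [σ.top] at this
  have e : {j : Fin σ.length | j.castSucc < Fin.last _ ∧ I j} = {j | I j} := by
    ext j
    simp [Fin.castSucc_lt_last]
  rw [e] at this
  exact this

/-- Torsion is avoided by passing to finite index: an infinite factor extends `N` by a power of `t`
that normalizes it, and a finite factor leaves `N` alone. Finite generation of `H` is carried along
to find that power. -/
theorem PolycyclicSeries.exists_hasTopClass {G : Type*} [Group G] (σ : PolycyclicSeries G) :
    ∃ N : Subgroup G, ListChain.HasTopClass N σ.hirsch := by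
  have := σ.induction (P := fun H m => H.FG ∧ ∃ N ≤ H, N.relIndex H ≠ 0 ∧
    ListChain.HasTopClass N m) ⟨⟨∅, by simp⟩, ⊥, le_rfl, by simp, ListChain.hasTopClass_bot⟩ ?_ ?_
  · obtain ⟨-, N, -, -, hN⟩ := this
    exact ⟨N, hN⟩
  · rintro H M t m h ⟨hfg, N, hNH, hN, hm⟩
    refine ⟨h.eq_sup ▸ hfg.sup ⟨{t}, by simp [Subgroup.zpowers_eq_closure]⟩, ?_⟩
    obtain ⟨r, hr, hconj⟩ := exists_pow_conj_mem_iff hfg hNH hN h.conj_mem_iff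
    refine ⟨cyclicExtension N (t ^ r) hconj, ?_,
      relIndex_cyclicExtension_ne_zero h.toIsCyclicExtension hN hr hconj,
      hm.extension ⟨isCyclicExtension_cyclicExtension hconj, fun k hk => ?_⟩⟩
    · rintro _ ⟨n, hn, k, rfl⟩
      exact mul_mem (h.le (hNH hn)) (zpow_mem (pow_mem h.mem r) k)
    · rw [← zpow_natCast, ← zpow_mul] at hk
      exact (mul_eq_zero.1 (h.eq_zero _ (hNH hk))).resolve_left (by exact_mod_cast hr.ne')
  · rintro H M t r m h hr ht ⟨hfg, N, hNH, hN, hm⟩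
    refine ⟨h.eq_sup ▸ hfg.sup ⟨{t}, by simp [Subgroup.zpowers_eq_closure]⟩, N, hNH.trans h.le, ?_,
      hm⟩
    rw [← Subgroup.relIndex_mul_relIndex N H M hNH h.le]
    exact mul_ne_zero hN (h.relIndex_ne_zero hr ht)

open scoped Pointwise

/-! ### Coloured dimension -/

section Colour

variable {G : Type*} [Group G]

/-- A coloured form of `LabelDimLE`: there are `n + 1` colours, and neighbours of the same colour
have the same label. -/
def ColorDimLE (H : Subgroup G) (n : ℕ) : Prop :=
  ∀ K : Set G, K.Finite → K ⊆ H → ∃ (c : G → Fin (n + 1)) (h : G → G) (D : Set G), D.Finite ∧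
    (∀ x ∈ H, x⁻¹ * h x ∈ D) ∧ ∀ x ∈ H, ∀ k ∈ K, c x = c (x * k) → h x = h (x * k)

/-- Turns labels of any type into labels in the group, equal exactly when the original labels are.
-/
theorem exists_representative {I : Type*} (H : Subgroup G) (l : G → I) :
    ∃ f : I → G, ∀ x ∈ H, f (l x) ∈ H ∧ l (f (l x)) = l x := by
  have : ∀ i, ∃ y, ∀ x ∈ H, l x = i → y ∈ H ∧ l y = i := fun i => by
    by_cases h : ∃ x ∈ H, l x = i
    · obtain ⟨x, hx, rfl⟩ := h
      exact ⟨x, fun _ _ _ => ⟨hx, rfl⟩⟩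
    · exact ⟨1, fun x hx e => absurd ⟨x, hx, e⟩ h⟩
  choose f hf using this
  exact ⟨f, fun x hx => hf _ x hx rfl⟩

theorem colorDimLE_bot : ColorDimLE (⊥ : Subgroup G) 0 := fun K _ hKH =>
  ⟨fun _ => 0, id, {1}, Set.finite_singleton 1, fun x _ => by simp, fun x _ k hk _ => by
    rw [Subgroup.mem_bot.1 (hKH hk), mul_one]⟩

/-- A chain of `n + 2` nonempty sets, the last with at most `n + 1` elements, is stationary
somewhere. -/
theorem exists_stationary {X : Type*} {F : ℕ → Set X} (hF : Monotone F) (h0 : (F 0).Nonempty)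
    {n : ℕ} (hn : (F (n + 1)).encard ≤ n + 1) : ∃ j ≤ n, F j = F (j + 1) := by
  by_contra! h
  have key : ∀ j ≤ n + 1, (j + 1 : ℕ∞) ≤ (F j).encard := fun j => by
    induction j with
    | zero => simpa using h0
    | succ j ih =>
      intro hj
      have hfin : (F j).Finite := Set.finite_of_encard_le_coe (k := n + 1)
        (by exact_mod_cast (Set.encard_le_encard (hF (by omega : j ≤ n + 1))).trans hn)
      have hlt : (F j).encard < (F (j + 1)).encard :=
        hfin.encard_lt_encard ((hF j.le_succ).ssubset_of_ne (h j (by omega)))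
      have := (add_le_add_left (ih (by omega)) 1)
      push_cast
      exact this.trans (Order.add_one_le_of_lt hlt)
  have := (key (n + 1) le_rfl).trans hn
  have : n + 1 + 1 ≤ n + 1 := by exact_mod_cast this
  omega

/-- The sets of labels seen from `x` within `j` steps increase with `j` and have at most `n + 1`
elements, so they stall at some `j ≤ n`. The stalled set is the new label and its size the colour.
Stalled sets of neighbours are nested, hence equal if their sizes agree. -/
theorem LabelDimLE.colorDimLE {H : Subgroup G} {n : ℕ} (hH : LabelDimLE H n) :
    ColorDimLE H n := by
  intro K hK hKH
  let K1 : Set G := insert 1 (K ∪ K⁻¹)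
  have hK1 : K1.Finite := (hK.union hK.inv).insert 1
  have hK1H : K1 ⊆ H := by
    rintro x (rfl | hx | hx)
    · exact one_mem H
    · exact hKH hx
    · exact inv_mem_iff.1 (hKH hx)
  have hpow : ∀ j, K1 ^ j ⊆ (H : Set G) := fun j => by
    induction j with
    | zero => simp
    | succ j ih =>
      rw [pow_succ]
      rintro _ ⟨x, hx, y, hy, rfl⟩
      exact mul_mem (ih hx) (hK1H hy)
  have hpowfin : ∀ j, (K1 ^ j).Finite := fun j => by
    induction j with
    | zero => simp
    | succ j ih => rw [pow_succ]; exact ih.mul hK1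
  have hmono : Monotone fun j => K1 ^ j := monotone_nat_of_le_succ fun j x hx => by
    rw [pow_succ]
    exact ⟨x, hx, 1, Or.inl rfl, mul_one x⟩
  obtain ⟨h, D, hD, hhD, hcard⟩ := hH (K1 ^ (n + 1)) (hpowfin _) (hpow _)
  let F : G → ℕ → Set G := fun x j => (fun k => h (x * k)) '' (K1 ^ j)
  have hFmono : ∀ x, Monotone (F x) := fun x i j hij => Set.image_mono (hmono hij)
  have hself : ∀ x j, h x ∈ F x j := fun x j =>
    hFmono x (Nat.zero_le j) ⟨1, by simp, by simp⟩
  have hfin : ∀ x j, (F x j).Finite := fun x j => (hpowfin _).image _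
  have hstep : ∀ x k j, k ∈ K1 → F (x * k) j ⊆ F x (j + 1) := by
    rintro x k j hk _ ⟨k', hk', rfl⟩
    refine ⟨k * k', ?_, by simp [mul_assoc]⟩
    rw [pow_succ']
    exact ⟨k, hk, k', hk', rfl⟩
  have : ∀ x, ∃ j, x ∈ H → j ≤ n ∧ F x j = F x (j + 1) := fun x => by
    by_cases hx : x ∈ H
    · obtain ⟨j, hj⟩ := exists_stationary (hFmono x) ⟨_, hself x 0⟩ (hcard x hx)
      exact ⟨j, fun _ => hj⟩
    · exact ⟨0, fun h => absurd h hx⟩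
  choose j hj using this
  have hnear : ∀ x k, x ∈ H → x * k ∈ H → k ∈ K1 → k⁻¹ ∈ K1 → j x ≤ j (x * k) →
      (F x (j x)).ncard = (F (x * k) (j (x * k))).ncard → F x (j x) = F (x * k) (j (x * k)) := by
    intro x k hx hxk hk hk' hle hc
    rcases hle.eq_or_lt with he | hlt
    · refine (Set.eq_of_subset_of_ncard_le ?_ hc.le (hfin _ _)).symm
      rw [(hj x hx).2, ← he]
      exact hstep x k _ hk
    · refine Set.eq_of_subset_of_ncard_le ?_ hc.ge (hfin _ _)
      have := hstep (x * k) k⁻¹ (j x) hk'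
      rw [mul_inv_cancel_right] at this
      exact this.trans (hFmono _ hlt)
  have hncard : ∀ x ∈ H, 1 ≤ (F x (j x)).ncard ∧ (F x (j x)).ncard ≤ n + 1 := fun x hx => by
    refine ⟨(Set.ncard_pos (hfin _ _)).2 ⟨_, hself x _⟩, ?_⟩
    have h1 := (Set.encard_le_encard (hFmono x (show j x ≤ n + 1 by
      have := (hj x hx).1; omega))).trans (hcard x hx)
    rw [← (hfin _ _).cast_ncard_eq] at h1
    exact_mod_cast h1
  obtain ⟨f, hf⟩ := exists_representative H fun x => F x (j x)
  refine ⟨fun x => ⟨min ((F x (j x)).ncard - 1) n, by omega⟩, fun x => f (F x (j x)),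
    D * D⁻¹ * (K1 ^ (n + 1))⁻¹, (hD.mul hD.inv).mul (hpowfin _).inv, fun x hx => ?_,
    fun x hx k hk hc => ?_⟩
  · obtain ⟨hy, e⟩ := hf x hx
    obtain ⟨y, hyf⟩ : ∃ y, f (F x (j x)) = y := ⟨_, rfl⟩
    change x⁻¹ * f (F x (j x)) ∈ _
    rw [hyf] at hy e ⊢
    -- The representative `y` sees the label `h x` within `n + 1` steps, which bounds its distance
    -- from `x`.
    have hxy : h x ∈ F y (j y) := by
      rw [e]
      exact hself x _
    obtain ⟨k, hk, hk'⟩ := hxy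
    have hk : k ∈ K1 ^ (n + 1) := hmono (show j y ≤ n + 1 by have := (hj y hy).1; omega) hk
    refine ⟨_, ⟨_, hhD x hx, _, Set.inv_mem_inv.2 (hhD (y * k) (mul_mem hy (hpow _ hk))), rfl⟩, _,
      Set.inv_mem_inv.2 hk, ?_⟩
    simp only at hk'
    simp only [hk']
    group
  · refine congrArg f ?_
    have hxk := mul_mem hx (hKH hk)
    have h1 := hncard x hx
    have h2 := hncard _ hxk
    have hc' := Fin.mk.inj hc
    have hcard' : (F x (j x)).ncard = (F (x * k) (j (x * k))).ncard := by omega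
    have hk1 : k ∈ K1 := Or.inr (Or.inl hk)
    have hk2 : k⁻¹ ∈ K1 := Or.inr (Or.inr (Set.inv_mem_inv.2 hk))
    rcases le_total (j x) (j (x * k)) with hle | hle
    · exact hnear x k hx hxk hk1 hk2 hle hcard'
    · have := hnear (x * k) k⁻¹ hxk (by simpa using hx) hk2 (by simpa using hk1)
      rw [mul_inv_cancel_right] at this
      exact (this hle hcard'.symm).symm

theorem encard_image_le_of_code {X Y : Type*} {K : Set X} {f : X → Y} {n : ℕ}
    (code : X → Fin (n + 1)) (h : ∀ k ∈ K, ∀ k' ∈ K, code k = code k' → f k = f k') :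
    (f '' K).encard ≤ n + 1 := by
  rcases K.eq_empty_or_nonempty with rfl | ⟨k₀, -⟩
  · simp
  have : ∀ i, ∃ y, ∀ k ∈ K, code k = i → y = f k := fun i => by
    by_cases h' : ∃ k ∈ K, code k = i
    · obtain ⟨k, hk, rfl⟩ := h'
      exact ⟨f k, fun k' hk' e => h k hk k' hk' e.symm⟩
    · exact ⟨f k₀, fun k hk e => absurd ⟨k, hk, e⟩ h'⟩
  choose g hg using this
  have : f '' K = g '' (code '' K) := by
    rw [Set.image_image]
    exact Set.image_congr fun k hk => (hg _ k hk rfl).symm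
  rw [this]
  refine (Set.encard_image_le _ _).trans ((Set.encard_le_encard (Set.subset_univ _)).trans ?_)
  simp

/-- Two points of one translate of `K` differ by an element of `K⁻¹ * K`, so on it the colour
determines the label. -/
theorem ColorDimLE.labelDimLE {H : Subgroup G} {n : ℕ} (hH : ColorDimLE H n) :
    LabelDimLE H n := by
  intro K hK hKH
  obtain ⟨c, h, D, hD, hhD, hc⟩ := hH (K⁻¹ * K) (hK.inv.mul hK) <| by
    rintro _ ⟨x, hx, y, hy, rfl⟩
    exact mul_mem (inv_mem_iff.1 (hKH hx)) (hKH hy)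
  refine ⟨h, D, hD, hhD, fun x hx => ?_⟩
  refine encard_image_le_of_code (fun k => c (x * k)) fun k hk k' hk' e => ?_
  have := hc (x * k) (mul_mem hx (hKH hk)) (k⁻¹ * k') ⟨_, Set.inv_mem_inv.2 hk, _, hk', rfl⟩
  rw [show x * k * (k⁻¹ * k') = x * k' by group] at this
  exact this e

/-- Each point of `M` borrows the colour and label of a point of `N` at bounded distance. -/
theorem ColorDimLE.finite_extension {N M : Subgroup G} {t : G} {n r : ℕ} (hN : ColorDimLE N n)
    (h : IsCyclicExtension N M t) (hr : 0 < r) (ht : t ^ r ∈ N) : ColorDimLE M n := by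
  intro K hK hKM
  let T : Set G := (fun b : ℕ => t ^ b) '' Set.Iio r
  have hT : T.Finite := (Set.finite_Iio r).image _
  have : ∀ x, ∃ s, x ∈ M → s ∈ T ∧ x * s⁻¹ ∈ N := fun x => by
    by_cases hx : x ∈ M
    · obtain ⟨n, hn, k, rfl⟩ := (h.mem_iff x).1 hx
      have hr' : (r : ℤ) ≠ 0 := by exact_mod_cast hr.ne'
      obtain ⟨b, hb⟩ := Int.eq_ofNat_of_zero_le (Int.emod_nonneg k hr')
      have hbr := Int.emod_lt_of_pos k (show (0 : ℤ) < r by exact_mod_cast hr)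
      refine ⟨t ^ b, fun _ => ⟨⟨b, by simp only [Set.mem_Iio]; omega, rfl⟩, ?_⟩⟩
      have hk : k = r * (k / r) + b := by rw [← hb]; exact (Int.mul_ediv_add_emod k r).symm
      rw [hk, zpow_add, zpow_natCast, zpow_mul, zpow_natCast, ← mul_assoc, mul_inv_cancel_right]
      exact mul_mem hn (zpow_mem ht _)
    · exact ⟨1, fun h => absurd h hx⟩
  choose s hs using this
  obtain ⟨c, f, D, hD, hfD, hc⟩ := hN ((T * K * T⁻¹) ∩ N) (((hT.mul hK).mul hT.inv).inter_of_left _)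
    Set.inter_subset_right
  refine ⟨fun x => c (x * (s x)⁻¹), fun x => f (x * (s x)⁻¹), T⁻¹ * D, hT.inv.mul hD,
    fun x hx => ?_, fun x hx k hk e => ?_⟩
  · obtain ⟨h1, h2⟩ := hs x hx
    refine ⟨_, Set.inv_mem_inv.2 h1, _, hfD _ h2, ?_⟩
    simp [mul_assoc]
  · obtain ⟨h1, h2⟩ := hs x hx
    obtain ⟨h3, h4⟩ := hs (x * k) (mul_mem hx (hKM hk))
    have e1 : x * (s x)⁻¹ * (s x * k * (s (x * k))⁻¹) = x * k * (s (x * k))⁻¹ := by group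
    have := hc _ h2 (s x * k * (s (x * k))⁻¹) ⟨⟨_, ⟨_, h1, _, hk, rfl⟩, _, Set.inv_mem_inv.2 h3, rfl⟩,
      (Subgroup.mul_mem_cancel_left _ h2).1 (by rw [e1]; exact h4)⟩
    rw [e1] at this
    exact this e

end Colour

/-! ### Slabs -/

section Slab

variable {G : Type*} [Group G]

/-- Uniform colourings of the slabs of height `L` in an infinite cyclic extension. -/
theorem ColorDimLE.exists_slab_coloring {N M : Subgroup G} {t : G} {n : ℕ} (hN : ColorDimLE N n)
    (h : IsInfiniteCyclicExtension N M t) {q : G → ℤ} (hq : ∀ x ∈ M, x * t ^ (-q x) ∈ N)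
    {K : Set G} (hK : K.Finite) (hKM : K ⊆ M) (L : ℤ) :
    ∃ (c : ℤ → G → Fin (n + 1)) (f : ℤ → G → G) (D : Set G), D.Finite ∧
      ∀ p, ∀ x ∈ M, |q x - p| ≤ L → x⁻¹ * f p x ∈ D ∧ ∀ k ∈ K, |q (x * k) - p| ≤ L →
        c p x = c p (x * k) → f p x = f p (x * k) := by
  let T : Set G := (fun i : ℤ => t ^ i) '' {i | |i| ≤ L}
  have hT : T.Finite := by
    refine Set.Finite.image _ ((Set.finite_Icc (-L) L).subset fun i hi => abs_le.1 hi)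
  have hTi : ∀ i : ℤ, |i| ≤ L → t ^ i ∈ T := fun i hi => ⟨i, hi, rfl⟩
  obtain ⟨c, f, D, hD, hfD, hc⟩ := hN ((T * K * T⁻¹) ∩ N) (((hT.mul hK).mul hT.inv).inter_of_left _)
    Set.inter_subset_right
  -- The slab around height `p` is moved to height 0 by `t ^ (-p)` and then flattened onto `N` by a
  -- right factor of bounded exponent. One colouring of `N` thus serves all slabs, with a bound
  -- independent of `p`.
  let ν : ℤ → G → G := fun p x => t ^ (-p) * x * t ^ (p - q x)
  have hν : ∀ p, ∀ x ∈ M, ν p x ∈ N := fun p x hx => by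
    have := h.zpow_conj_mem (-p) _ (hq x hx)
    convert this using 1
    simp only [ν, zpow_sub, zpow_neg]
    have := (Commute.refl t).zpow_zpow p (q x)
    rw [(this.inv_right).eq]
    group
  refine ⟨fun p x => c (ν p x), fun p x => t ^ p * f (ν p x), T⁻¹ * D, hT.inv.mul hD,
    fun p x hx hxp => ⟨?_, fun k hk hkp e => ?_⟩⟩
  · refine ⟨_, Set.inv_mem_inv.2 (hTi _ hxp), _, hfD _ (hν p x hx), ?_⟩
    simp only [ν]
    group
  · have e1 : ν p x * (t ^ (q x - p) * k * (t ^ (q (x * k) - p))⁻¹) = ν p (x * k) := by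
      simp only [ν]
      group
    have := hc _ (hν p x hx) (t ^ (q x - p) * k * (t ^ (q (x * k) - p))⁻¹)
      ⟨⟨_, ⟨_, hTi _ hxp, _, hk, rfl⟩, _, Set.inv_mem_inv.2 (hTi _ hkp), rfl⟩,
      (Subgroup.mul_mem_cancel_left _ (hν p x hx)).1
        (by rw [e1]; exact hν p _ (mul_mem hx (hKM hk)))⟩
    rw [e1] at this
    simp only
    rw [this e]

end Slab

/-! ### Transitions between slabs -/

section Transition

/-- The multiple of `2 * L` nearest to `q`. -/
def slabNode (L q : ℤ) : ℤ := 2 * L * ((q + L) / (2 * L))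

/-- The odd multiple of `L` nearest to `q`. -/
def slabTarget (L q : ℤ) : ℤ := if slabNode L q ≤ q then slabNode L q + L else slabNode L q - L

theorem slabNode_le {L : ℤ} (hL : 0 < L) (q : ℤ) :
    slabNode L q - L ≤ q ∧ q < slabNode L q + L := by
  have h1 := Int.mul_ediv_add_emod (q + L) (2 * L)
  have h2 := Int.emod_nonneg (q + L) (show 2 * L ≠ 0 by omega)
  have h3 := Int.emod_lt_of_pos (q + L) (show 0 < 2 * L by omega)
  unfold slabNode
  constructor <;> linarith

theorem slabNode_eq {L : ℤ} (hL : 0 < L) {q j : ℤ} (h1 : 2 * L * j - L ≤ q)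
    (h2 : q < 2 * L * j + L) : slabNode L q = 2 * L * j := by
  have : (q + L) / (2 * L) = j := by
    refine le_antisymm ?_ ?_
    · refine Int.lt_add_one_iff.1 ((Int.ediv_lt_iff_lt_mul (by omega)).2 ?_)
      linarith
    · rw [Int.le_ediv_iff_mul_le (by omega)]
      linarith
  rw [slabNode, this]

theorem abs_sub_slabNode_le {L : ℤ} (hL : 0 < L) (q : ℤ) : |q - slabNode L q| ≤ L := by
  have := slabNode_le hL q
  rw [abs_le]
  constructor <;> linarith

theorem abs_slabNode_sub_slabTarget {L : ℤ} (hL : 0 < L) (q : ℤ) :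
    |slabNode L q - slabTarget L q| = L := by
  unfold slabTarget
  split_ifs
  · rw [sub_add_cancel_left, abs_neg, abs_of_pos hL]
  · rw [sub_sub_cancel, abs_of_pos hL]

/-- A short set of heights either has a common node, or it is close to a common target. -/
theorem slab_dichotomy {L w : ℤ} (hw : 0 < w) (hwL : w ≤ L) {S : Set ℤ}
    (hS : ∀ q ∈ S, ∀ q' ∈ S, q - q' < w) :
    (∃ p, ∀ q ∈ S, slabNode L q = p) ∨
      ∃ b, ∀ q ∈ S, slabTarget L q = b ∧ L - w ≤ |q - slabNode L q| := by
  have hL : 0 < L := hw.trans_le hwL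
  -- Heights with different nodes lie on both sides of one odd multiple of `L`, which is then the
  -- target of the whole set.
  by_cases h : ∃ q ∈ S, ∃ q' ∈ S, slabNode L q < slabNode L q'
  · right
    obtain ⟨q, hq, q', hq', hlt⟩ := h
    obtain ⟨h1, h2⟩ := slabNode_le hL q
    obtain ⟨h3, h4⟩ := slabNode_le hL q'
    have hd := hS q' hq' q hq
    have hj : (q' + L) / (2 * L) = (q + L) / (2 * L) + 1 := by
      unfold slabNode at hlt h2 h3
      generalize (q' + L) / (2 * L) = j' at *
      generalize (q + L) / (2 * L) = j at *
      have e1 : j < j' := lt_of_mul_lt_mul_left hlt (by omega)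
      have e2 : 2 * L * j' < 2 * L * (j + 2) := by linarith
      have e3 := lt_of_mul_lt_mul_left e2 (by omega)
      omega
    have hnode : slabNode L q' = slabNode L q + 2 * L := by
      unfold slabNode
      rw [hj]
      ring
    refine ⟨slabNode L q + L, fun r hr => ?_⟩
    have hd1 := hS r hr q hq
    have hd2 := hS q' hq' r hr
    by_cases hrb : r < slabNode L q + L
    · have hr : slabNode L r = slabNode L q := slabNode_eq hL (j := (q + L) / (2 * L))
        (by change slabNode L q - L ≤ r; linarith) hrb
      rw [slabTarget, hr, if_pos (by linarith), abs_of_nonneg (by linarith)]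
      exact ⟨rfl, by linarith⟩
    · have hr : slabNode L r = slabNode L q' := slabNode_eq hL (j := (q' + L) / (2 * L))
        (by change slabNode L q' - L ≤ r; linarith) (by change r < slabNode L q' + L; linarith)
      rw [slabTarget, hr, if_neg (by linarith), abs_of_nonpos (by linarith)]
      exact ⟨by linarith, by linarith⟩
  · left
    push Not at h
    rcases S.eq_empty_or_nonempty with rfl | ⟨q, hq⟩
    · exact ⟨0, by simp⟩
    · exact ⟨slabNode L q, fun r hr => le_antisymm (h q hq r hr) (h r hr q hq)⟩

theorem ediv_le_ediv_add_one {a b w : ℤ} (hw : 0 < w) (h : b - a < w) : b / w ≤ a / w + 1 := by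
  have := Int.add_mul_ediv_right a 1 hw.ne'
  rw [one_mul] at this
  rw [← this]
  exact Int.ediv_le_ediv hw (by linarith)

theorem slabTarget_eq {L w q q' : ℤ} (hp : slabNode L q = slabNode L q')
    (hq : w ≤ |q - slabNode L q|) (hq' : w ≤ |q' - slabNode L q'|) (h1 : q - q' < w)
    (h2 : q' - q < w) : slabTarget L q = slabTarget L q' := by
  unfold slabTarget
  rw [hp] at hq ⊢
  generalize slabNode L q' = p at *
  split_ifs with h3 h4 h4
  · rfl
  · rw [abs_of_nonneg (by omega)] at hq
    rw [abs_of_nonpos (by omega)] at hq'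
    omega
  · rw [abs_of_nonpos (by omega)] at hq
    rw [abs_of_nonneg (by omega)] at hq'
    omega
  · rfl

end Transition

/-! ### The upper bound for infinite cyclic extensions -/

section Extension

variable {G : Type*} [Group G] {N M : Subgroup G} {t : G}

/-- System A labels the slabs around the nodes, system B those around the targets. A point of
A-colour `c` in layer `s` (its distance to the node in units of `w`) keeps its A-label while `c + s
< m + 1` and then takes a B-label. The B-label is read at the representative `r x` of the A-class,
so that it depends only on that class and the target. -/
theorem ColorDimLE.infinite_extension {m : ℕ} (hN : ColorDimLE N m)
    (h : IsInfiniteCyclicExtension N M t) : LabelDimLE M (m + 1) := by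
  intro K hK hKM
  obtain ⟨q, hq1, hqN, hqt⟩ := h.exists_height
  have hqMul : ∀ x ∈ M, x * t ^ (-q x) ∈ N := fun x hx => by
    obtain ⟨n, hn, k, rfl⟩ := (h.mem_iff x).1 hx
    have := hqt k 1
    rw [mul_one, hq1, zero_add] at this
    rw [hqN n hn, this]
    simpa using hn
  have hqadd : ∀ x ∈ M, ∀ y, q (x * y) = q x + q y := fun x hx y => by
    have e : x * y = (x * t ^ (-q x)) * (t ^ (q x) * y) := by group
    rw [e, hqN _ (hqMul x hx), hqt, add_comm]
  obtain ⟨Q, hQ⟩ := ((hK.image fun k => |q k|)).bddAbove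
  let w : ℤ := 2 * |Q| + 1
  have hw : 0 < w := by have := abs_nonneg Q; omega
  have hKw : ∀ k ∈ K, ∀ k' ∈ K, q k - q k' < w := fun k hk k' hk' => by
    have h1 := abs_le.1 ((hQ ⟨k, hk, rfl⟩).trans (le_abs_self Q))
    have h2 := abs_le.1 ((hQ ⟨k', hk', rfl⟩).trans (le_abs_self Q))
    omega
  -- A slab has room for `m + 1` layers of width `w` in which the colours switch, and a last one in
  -- which all have switched.
  let L : ℤ := (m + 2) * w
  have hLw : L - w = (m + 1) * w := by simp only [L]; ring
  have hwL : w ≤ L := by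
    have : 0 ≤ (m + 1 : ℤ) * w := by positivity
    linarith
  have hL : 0 < L := hw.trans_le hwL
  let P : G → ℤ := fun x => slabNode L (q x)
  have hPL : ∀ x, |q x - P x| ≤ L := fun x => abs_sub_slabNode_le hL _
  have hKK : K⁻¹ * K ⊆ (M : Set G) := by
    rintro _ ⟨x, hx, y, hy, rfl⟩
    exact mul_mem (inv_mem_iff.1 (hKM hx)) (hKM hy)
  obtain ⟨cA, fA, DA, hDA, hA⟩ := hN.exists_slab_coloring h hqMul (hK.inv.mul hK) hKK L
  obtain ⟨rep, hrep⟩ := exists_representative M fun x => (P x, fA (P x) x, cA (P x) x)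
  let r : G → G := fun x => rep (P x, fA (P x) x, cA (P x) x)
  have hrM : ∀ x ∈ M, r x ∈ M := fun x hx => (hrep x hx).1
  have hrP : ∀ x ∈ M, P (r x) = P x := fun x hx => congrArg Prod.fst (hrep x hx).2
  have hrf : ∀ x ∈ M, fA (P x) (r x) = fA (P x) x := fun x hx => by
    have := congrArg (fun a => a.2.1) (hrep x hx).2
    rwa [show P (rep _) = P x from hrP x hx] at this
  have hrD : ∀ x ∈ M, x⁻¹ * r x ∈ DA * DA⁻¹ := fun x hx => by
    have h1 := (hA (P x) x hx (hPL x)).1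
    have h2 := (hA (P x) (r x) (hrM x hx) (by rw [← hrP x hx]; exact hPL _)).1
    refine ⟨_, h1, _, Set.inv_mem_inv.2 h2, ?_⟩
    simp only [hrf x hx]
    group
  have hE : (DA * DA⁻¹).Finite := hDA.mul hDA.inv
  -- System B must compare the representatives of neighbours, and these lie within `2 * L` of the
  -- target.
  obtain ⟨cB, fB, DB, hDB, hB⟩ := hN.exists_slab_coloring h hqMul
    (K := ((DA * DA⁻¹)⁻¹ * (K⁻¹ * K) * (DA * DA⁻¹)) ∩ M)
    (((hE.inv.mul (hK.inv.mul hK)).mul hE).inter_of_left _) Set.inter_subset_right (2 * L)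
  let o : G → ℤ := fun x => slabTarget L (q x)
  let s : G → ℤ := fun x => |q x - P x| / w
  have hro : ∀ x ∈ M, |q (r x) - o x| ≤ 2 * L := fun x hx => by
    have h1 := hPL (r x)
    rw [hrP x hx] at h1
    have h2 := abs_slabNode_sub_slabTarget hL (q x)
    calc |q (r x) - o x| ≤ |q (r x) - P x| + |P x - o x| := abs_sub_le _ _ _
      _ ≤ L + L := add_le_add h1 h2.le
      _ = 2 * L := by ring
  let g : G → G := fun x => if (cA (P x) x : ℤ) + s x < m + 1 then r x else fB (o x) (r x)
  refine ⟨g, DA * DA⁻¹ ∪ DA * DA⁻¹ * DB, hE.union (hE.mul hDB), fun x hx => ?_, fun x hx => ?_⟩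
  · by_cases hc : (cA (P x) x : ℤ) + s x < m + 1
    · exact Or.inl (by simpa only [g, if_pos hc] using hrD x hx)
    · refine Or.inr ⟨_, hrD x hx, _, (hB (o x) (r x) (hrM x hx) (hro x hx)).1, ?_⟩
      simp only [g, if_neg hc]
      group
  have hxk : ∀ k ∈ K, x * k ∈ M := fun k hk => mul_mem hx (hKM hk)
  have hw' : ∀ k ∈ K, ∀ k' ∈ K, q (x * k) - q (x * k') < w := fun k hk k' hk' => by
    rw [hqadd x hx, hqadd x hx]
    linarith [hKw k hk k' hk']
  have hr : ∀ k ∈ K, ∀ k' ∈ K, P (x * k) = P (x * k') →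
      cA (P (x * k)) (x * k) = cA (P (x * k')) (x * k') → r (x * k) = r (x * k') := by
    intro k hk k' hk' hP hc
    have := (hA (P (x * k)) (x * k) (hxk k hk) (hPL _)).2 (k⁻¹ * k')
      ⟨_, Set.inv_mem_inv.2 hk, _, hk', rfl⟩
    rw [show x * k * (k⁻¹ * k') = x * k' by group] at this
    have hf := this (by rw [hP]; exact hPL _) (by rw [hc, hP])
    simp only [r]
    rw [hf, hc, hP]
  have hS := slab_dichotomy hw hwL (S := (fun k => q (x * k)) '' K) <| by
    rintro _ ⟨k, hk, rfl⟩ _ ⟨k', hk', rfl⟩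
    exact hw' k hk k' hk'
  push_cast
  rcases hS with ⟨p, hp⟩ | ⟨b, hb⟩
  · have hP : ∀ k ∈ K, P (x * k) = p := fun k hk => hp _ ⟨k, hk, rfl⟩
    -- With a common node, an unswitched colour `c` is coded as `c` and a switched one as `c + 1`. A
    -- clash would need an unswitched `c + 1` beside a switched `c`, so layers at least two apart,
    -- while they differ by at most one.
    refine encard_image_le_of_code (n := m + 1) (fun k =>
      if (cA (P (x * k)) (x * k) : ℤ) + s (x * k) < m + 1 then (cA (P (x * k)) (x * k)).castSucc
      else (cA (P (x * k)) (x * k)).succ) fun k hk k' hk' e => ?_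
    have hs : ∀ k ∈ K, ∀ k' ∈ K, s (x * k) ≤ s (x * k') + 1 := fun k hk k' hk' => by
      refine ediv_le_ediv_add_one hw ?_
      have h1 := hw' k hk k' hk'
      have h2 := hw' k' hk' k hk
      rw [hP k hk, hP k' hk']
      calc _ ≤ |q (x * k) - p - (q (x * k') - p)| := abs_sub_abs_le_abs_sub _ _
        _ < w := by rw [abs_lt]; constructor <;> linarith
    have hPP : P (x * k) = P (x * k') := by rw [hP k hk, hP k' hk']
    have hs1 := hs k hk k' hk'
    have hs2 := hs k' hk' k hk
    have hr' := hr k hk k' hk' hPP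
    simp only [g]
    split_ifs at e ⊢ with h1 h2 h2
    · exact hr' (Fin.castSucc_injective _ e)
    · have := congrArg Fin.val e
      simp only [Fin.val_castSucc, Fin.val_succ] at this
      omega
    · have := congrArg Fin.val e
      simp only [Fin.val_castSucc, Fin.val_succ] at this
      omega
    · have hc := Fin.succ_injective _ e
      rw [hr' hc]
      congr 1
      -- A switched point has `s ≥ 1`, as its colour is at most `m`. So it is at least `w` from the
      -- node, and nearby switched points lie on the same side.
      have hpos : ∀ k, ¬ (cA (P (x * k)) (x * k) : ℤ) + s (x * k) < m + 1 →
          w ≤ |q (x * k) - P (x * k)| := fun k h => by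
        have := (cA (P (x * k)) (x * k)).is_lt
        have h1 : 1 ≤ s (x * k) := by omega
        simpa using (Int.le_ediv_iff_mul_le hw).1 h1
      exact slabTarget_eq hPP (hpos k h1) (hpos k' h2) (hw' k hk k' hk') (hw' k' hk' k hk)
  -- Near the end of a slab all colours have switched, and the `m + 1` colours of system B suffice.
  · refine encard_image_le_of_code (n := m + 1) (fun k => (cB b (r (x * k))).castSucc)
      fun k hk k' hk' e => ?_
    have ho : ∀ k ∈ K, o (x * k) = b := fun k hk => (hb _ ⟨k, hk, rfl⟩).1
    have hs : ∀ k ∈ K, ¬ (cA (P (x * k)) (x * k) : ℤ) + s (x * k) < m + 1 := fun k hk => by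
      have h1 := (hb _ ⟨k, hk, rfl⟩).2
      rw [hLw] at h1
      have h2 : (m + 1 : ℤ) ≤ s (x * k) := (Int.le_ediv_iff_mul_le hw).2 h1
      omega
    simp only [g]
    rw [if_neg (hs k hk), if_neg (hs k' hk'), ho k hk, ho k' hk']
    have h1 := hro _ (hxk k hk)
    have h2 := hro _ (hxk k' hk')
    rw [ho k hk] at h1
    rw [ho k' hk'] at h2
    have := (hB b _ (hrM _ (hxk k hk)) h1).2 ((r (x * k))⁻¹ * r (x * k')) ⟨?_, ?_⟩
    · rw [mul_inv_cancel_left] at this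
      exact this h2 (Fin.castSucc_injective _ e)
    · refine ⟨_, ⟨_, Set.inv_mem_inv.2 (hrD _ (hxk k hk)), k⁻¹ * k',
        ⟨_, Set.inv_mem_inv.2 hk, _, hk', rfl⟩, rfl⟩, _, hrD _ (hxk k' hk'), ?_⟩
      group
    · exact mul_mem (inv_mem (hrM _ (hxk k hk))) (hrM _ (hxk k' hk'))

theorem PolycyclicSeries.labelDimLE (σ : PolycyclicSeries G) :
    LabelDimLE (⊤ : Subgroup G) σ.hirsch :=
  (σ.induction (P := ColorDimLE) colorDimLE_bot
    (fun _ _ _ _ h hN => (hN.infinite_extension h).colorDimLE)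
    fun _ _ _ _ _ h hr ht hN => hN.finite_extension h hr ht).labelDimLE

theorem PolycyclicSeries.hirsch_le (σ : PolycyclicSeries G) {n : ℕ}
    (h : LabelDimLE (⊤ : Subgroup G) n) : σ.hirsch ≤ n := by
  obtain ⟨N, hN⟩ := σ.exists_hasTopClass
  exact hN.le_of_labelDimLE h

end Extension

/-! ### Comparison with the asymptotic dimension of the word metric -/

section WordMetricComparison

variable {G : Type*} [Group G] {S : Set G}

theorem finite_wordNorm_le (hS : IsFiniteSymmGenSet S) (R : ℝ) :
    {g : G | (wordNorm S g : ℝ) ≤ R}.Finite := by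
  have : (⋃ d ∈ Set.Iic ⌊R⌋₊, List.prod '' {l : List G | l.length = d ∧ ∀ x ∈ l, x ∈ S}).Finite :=
    (Set.finite_Iic _).biUnion fun d _ => (ListChain.finite_lists hS.finite d).image _
  refine this.subset fun g hg => ?_
  obtain ⟨l, hl, hlg, hlen⟩ := exists_word hS g
  exact Set.mem_biUnion (x := wordNorm S g) (Nat.le_floor hg) ⟨l, ⟨hlen, hl⟩, hlg⟩

theorem exists_wordNorm_le {D : Set G} (hD : D.Finite) :
    ∃ R : ℝ, ∀ g ∈ D, (wordNorm S g : ℝ) ≤ R := by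
  obtain ⟨R, hR⟩ := (hD.image fun g => (wordNorm S g : ℝ)).bddAbove
  exact ⟨R, fun g hg => hR ⟨g, hg, rfl⟩⟩

theorem isOpen_wordMetricSpace (hS : IsFiniteSymmGenSet S) (U : Set G) :
    letI := wordMetricSpace S hS
    IsOpen U := by
  let _ := wordMetricSpace S hS
  refine Metric.isOpen_iff.2 fun x hx => ⟨1, one_pos, fun y hy => ?_⟩
  have hy' : (wordNorm S (y⁻¹ * x) : ℝ) < 1 := hy
  have h0 : wordNorm S (y⁻¹ * x) = 0 := by
    have : wordNorm S (y⁻¹ * x) < 1 := by exact_mod_cast hy'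
    omega
  rwa [inv_mul_eq_one.1 (eq_one_of_wordNorm_eq_zero hS h0)]

/-- Each point chooses a member of the cover that contains its neighbourhood `V`. The members chosen
on `x K` all contain `x`, so the multiplicity at `x` bounds their number. -/
theorem labelDimLE_of_asdimLE (hS : IsFiniteSymmGenSet S) {n : ℕ}
    (h : letI := wordMetricSpace S hS; AsdimLE G n) : LabelDimLE (⊤ : Subgroup G) n := by
  let _ := wordMetricSpace S hS
  intro K hK _
  have hK' : (insert 1 K⁻¹).Finite := hK.inv.insert 1
  let V : G → Set G := fun x => (x * ·) '' insert 1 K⁻¹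
  have hself : ∀ x, x ∈ V x := fun x => ⟨1, Or.inl rfl, mul_one x⟩
  obtain ⟨R, hR⟩ := exists_wordNorm_le (S := S) (hK'.inv.mul hK')
  obtain ⟨𝒰, h𝒰, hmult, href⟩ := h (Set.range V)
    { isOpen := fun U _ => isOpen_wordMetricSpace hS U
      covers := Set.eq_univ_of_forall fun x => ⟨V x, ⟨x, rfl⟩, hself x⟩
      bounded := by
        refine ⟨R, ?_⟩
        rintro _ ⟨x, rfl⟩ _ ⟨a, ha, rfl⟩ _ ⟨b, hb, rfl⟩
        change (wordNorm S ((x * a)⁻¹ * (x * b)) : ℝ) ≤ R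
        rw [show (x * a)⁻¹ * (x * b) = a⁻¹ * b by group]
        exact hR _ ⟨_, Set.inv_mem_inv.2 ha, _, hb, rfl⟩ }
  choose f hf𝒰 hVf using fun x => href (V x) ⟨x, rfl⟩
  obtain ⟨rep, hrep⟩ := exists_representative (⊤ : Subgroup G) f
  obtain ⟨R', hR'⟩ := h𝒰.bounded
  refine ⟨fun x => rep (f x), _, finite_wordNorm_le hS R', fun x hx => ?_, fun x _ => ?_⟩
  · refine hR' (f x) (hf𝒰 x) x (hVf x (hself x)) _ ?_
    have := hVf (rep (f x)) (hself _)
    rwa [(hrep x hx).2] at this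
  · rw [show (fun k => rep (f (x * k))) '' K = rep '' ((fun k => f (x * k)) '' K) by
      rw [Set.image_image]]
    refine (Set.encard_image_le _ _).trans ((Set.encard_le_encard ?_).trans (hmult x))
    rintro _ ⟨k, hk, rfl⟩
    exact ⟨hf𝒰 _, hVf _ ⟨k⁻¹, Or.inr (Set.inv_mem_inv.2 hk), by simp⟩⟩

/-- The member attached to a label consists of the points that see it within the ball of radius `R`.
So multiplicity counts the labels on one translate of the ball, and a set of diameter at most `R`
sees the label of any of its points. -/
theorem LabelDimLE.asdimLE (hS : IsFiniteSymmGenSet S) {n : ℕ}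
    (h : LabelDimLE (⊤ : Subgroup G) n) : letI := wordMetricSpace S hS; AsdimLE G n := by
  let _ := wordMetricSpace S hS
  intro 𝒱 h𝒱
  obtain ⟨R, hR⟩ := h𝒱.bounded
  have hK : (insert 1 {g : G | (wordNorm S g : ℝ) ≤ R}).Finite := (finite_wordNorm_le hS R).insert 1
  obtain ⟨f, D, hD, hfD, hcard⟩ := h _ hK fun _ _ => trivial
  let U : G → Set G := fun i => {x | ∃ k ∈ insert 1 {g : G | (wordNorm S g : ℝ) ≤ R}, f (x * k) = i}
  obtain ⟨R', hR'⟩ := exists_wordNorm_le (S := S) (hK.mul (hD.mul hD.inv |>.mul hK.inv))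
  refine ⟨Set.range fun x => U (f x), ⟨fun U _ => isOpen_wordMetricSpace hS U,
    Set.eq_univ_of_forall fun x => ⟨_, ⟨x, rfl⟩, 1, Or.inl rfl, by rw [mul_one]⟩, R', ?_⟩, ?_, ?_⟩
  · rintro _ ⟨z, rfl⟩ x ⟨k, hk, e⟩ y ⟨k', hk', e'⟩
    refine hR' _ ⟨k, hk, _, ⟨_, ⟨_, hfD (x * k) trivial, _,
      Set.inv_mem_inv.2 (hfD (y * k') trivial), rfl⟩, _, Set.inv_mem_inv.2 hk', rfl⟩, ?_⟩
    simp only [e, e']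
    group
  · intro x
    refine le_trans (Set.encard_le_encard ?_) ((Set.encard_image_le U _).trans (hcard x trivial))
    rintro _ ⟨⟨z, rfl⟩, k, hk, e⟩
    exact ⟨f (x * k), ⟨k, hk, rfl⟩, congrArg U e⟩
  · intro V hV
    rcases V.eq_empty_or_nonempty with rfl | ⟨v, hv⟩
    · exact ⟨_, ⟨1, rfl⟩, Set.empty_subset _⟩
    · refine ⟨_, ⟨v, rfl⟩, fun y hy => ⟨y⁻¹ * v, Or.inr (hR V hV y hy v hv), ?_⟩⟩
      rw [mul_inv_cancel_left]

theorem PolycyclicSeries.asdimWord_eq (σ : PolycyclicSeries G) (hS : IsFiniteSymmGenSet S) :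
    asdimWord S hS = σ.hirsch := by
  let _ := wordMetricSpace S hS
  refine le_antisymm (iInf₂_le _ (σ.labelDimLE.asdimLE hS)) (le_iInf₂ fun n hn => ?_)
  exact_mod_cast σ.hirsch_le (labelDimLE_of_asdimLE hS hn)

end WordMetricComparison

/-- For a finitely generated polycyclic group the asymptotic dimension equals the Hirsch length;
neither the finite symmetric generating set nor the polycyclic series matters. -/
theorem mainTheorem11 (Γ : Type*) [Group Γ] [Group.FG Γ] (hΓ : IsPolycyclic Γ) :
    groupAsdim Γ = (hirschLength Γ hΓ : ℕ∞) ∧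
      (∀ (S : Set Γ) (hS : IsFiniteSymmGenSet S), asdimWord S hS = groupAsdim Γ) ∧
      (∀ σ : PolycyclicSeries Γ, σ.hirsch = hirschLength Γ hΓ) := by
  refine ⟨(Classical.choice hΓ).asdimWord_eq _, fun S hS => ?_, fun σ => ?_⟩
  · rw [groupAsdim, (Classical.choice hΓ).asdimWord_eq, (Classical.choice hΓ).asdimWord_eq]
  · exact le_antisymm (σ.hirsch_le (Classical.choice hΓ).labelDimLE)
      ((Classical.choice hΓ).hirsch_le σ.labelDimLE)
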